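/- Let $N$ be a connected Lie group with 2-step nilpotent Lie algebra $\mathfrak n$ (that is, $[\mathfrak n,\mathfrak n]\subseteq\mathfrak z$, where $\mathfrak z$ is the center of $\mathfrak n$), let $\langle\,,\rangle$ be an inner product on $\mathfrak n$ (a nondegenerate symmetric bilinear form, not necessarily definite), and give $N$ the induced left-invariant pseudoriemannian metric tensor. Let $$\mathfrak n=\mathfrak U\oplus\mathfrak Z\oplus\mathfrak V\oplus\mathfrak E$$ be a decomposition in which $\mathfrak z=\mathfrak U\oplus\mathfrak Z$, $\mathfrak U=\mathfrak z\cap\mathfrak z^\perp$, $\mathfrak V$ is a null subspace complementary to $\mathfrak U$, and $\mathfrak U^\perp\cap\mathfrak V^\perp=\mathfrak Z\oplus\mathfrak E$ is an orthogonal direct sum; superscripts denote components. Let $\mathrm{ad}^\dagger_x$ be the adjoint of $\mathrm{ad}_x$ with respect to $\langle\,,\rangle$. Let $u_0\in\mathfrak U$, $z_0\in\mathfrak Z$, $v_0\in\mathfrak V$, $e_0\in\mathfrak E$ be arbitrary, and put, for $y\in\mathfrak V\oplus\mathfrak E$, $$\mathscr Jy=\bigl(\mathrm{ad}^\dagger_y(z_0+v_0)\bigr)^{\mathfrak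 E},\qquad \mathcal Jy=\bigl(\mathrm{ad}^\dagger_y(z_0+v_0)\bigr)^{\mathfrak U},\qquad J=\mathscr J|_{\mathfrak E}\in\mathrm{End}(\mathfrak E).$$ For a curve $x(t)$ in $\mathfrak V\oplus\mathfrak E$ put $\mathscr I[\dot x,x](t)=-\frac12\int_0^t[\dot x(s),x(s)]\,ds$ and $$z(t)=t\,z_0+\mathscr I[\dot x,x]^{\mathfrak Z},\qquad u(t)=t\,u_0+\mathscr I[\dot x,x]^{\mathfrak U}+\int_0^t\!\!\int_0^s\mathcal J\dot x(\sigma)\,d\sigma\,ds .$$ Say that $x$ *integrates the geodesic equations* if $\gamma(t)=\exp\bigl(x(t)+z(t)+u(t)\bigr)$ is a geodesic of $N$ defined for all $t\in\mathbb R$ with $\gamma(0)=1$ and $\dot\gamma(0)=u_0+z_0+v_0+e_0$, and if on every open interval containing $0$ it is the only geodesic with these initial conditions, and $x+z+u$ is the only $C^2$ curve in $\mathfrak n$ starting at $0$ with initial velocity $u_0+z_0+v_0+e_0$ whose exponential is a geodesic. 1. (Complete integrability.) For all initial data, $$x(t)=t\,v_0+\int_0^t\Bigl(e^{sJ}e_0+\int_0^s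 e^{\sigma J}\mathscr Jv_0\,d\sigma\Bigr)ds$$ integrates the geodesic equations. 2. (Explicit formulas.) Let $\mathfrak E_1=\ker J$, let $\mathfrak E_2$ be its orthogonal complement in $\mathfrak E$, and suppose that $\mathfrak E=\mathfrak E_1\oplus\mathfrak E_2$ (equivalently, that $\ker J$ is nondegenerate; this is automatic if $\langle\,,\rangle$ is definite on $\mathfrak E$). Then $J$ maps $\mathfrak E_2$ bijectively onto itself; let $J^{-1}$ be the inverse there. Decompose $e_0=e_1+e_2$ and $\mathscr Jv_0=y_1+y_2$ in $\mathfrak E_1\oplus\mathfrak E_2$, and put $x_1=e_1+v_0-J^{-1}y_2$, $x_2=e_2+J^{-1}y_2$. Then $$x(t)=t\,x_1+\bigl(e^{tJ}-I\bigr)J^{-1}x_2+\tfrac12t^2y_1$$ integrates the geodesic equations, and for all $t$ $$\begin{aligned}\mathscr I[\dot x,x]={}&\tfrac12t\bigl[x_1+\tfrac12t\,y_1,(e^{tJ}+I)J^{-1}x_2\bigr]-t\bigl[y_1,e^{tJ}J^{-2}x_2\bigr]+\tfrac1{12}t^3[x_1,y_1]\\&+\tfrac12\bigl[(e^{tJ}-I)J^{-1}x_2,J^{-1}x_2\bigr]-\bigl[x_1,(e^{tJ}-I)J^{-2}x_2\bigr]\\&+\bigl[y_1,(e^{tJ}-I)J^{-3}x_2\bigr]+\tfrac12\int_0^t\bigl[e^{sJ}J^{-1}x_2,e^{sJ}x_2\bigr]ds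 .\end{aligned}$$ 3. (Geodesic completeness.) Every tangent vector of $N$ is the initial velocity of a geodesic that is defined for all times. -/

import Mathlib

open scoped Manifold ContDiff
open LinearMap (BilinForm)

noncomputable section

/-! ### Linear algebra of a Lie algebra with an inner product -/

section Algebra

variable {L : Type*} [LieRing L] [LieAlgebra ℝ L]

/-- A decomposition `𝔫 = 𝔘 ⊕ 𝔷' ⊕ 𝔙 ⊕ 𝔈` of a Lie algebra with an inner product `B` (a
nondegenerate symmetric bilinear form, not necessarily definite): the center is `𝔘 ⊕ 𝔷'`, where
`𝔘` is its null part `𝔷 ∩ 𝔷ᗮ`; `𝔙` is a null subspace complementary to `𝔘`; and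
`𝔘ᗮ ∩ 𝔙ᗮ = 𝔷' ⊕ 𝔈`, an orthogonal direct sum. -/
structure NullSplitting (B : BilinForm ℝ L) where
  (U Z V E : Submodule ℝ L)
  isInternal : DirectSum.IsInternal ![U, Z, V, E]
  center_eq : U ⊔ Z = (LieAlgebra.center ℝ L).toSubmodule
  U_eq : U = (LieAlgebra.center ℝ L).toSubmodule ⊓
    B.orthogonal (LieAlgebra.center ℝ L).toSubmodule
  V_null : ∀ v ∈ V, ∀ w ∈ V, B v w = 0
  ZE_eq : Z ⊔ E = B.orthogonal U ⊓ B.orthogonal V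
  Z_perp_E : ∀ z ∈ Z, ∀ e ∈ E, B z e = 0

namespace NullSplitting

variable {B : BilinForm ℝ L} (D : NullSplitting B)

/-- The projection of `𝔫` onto the `i`-th summand of `𝔘 ⊕ 𝔷' ⊕ 𝔙 ⊕ 𝔈`. -/
def proj (i : Fin 4) : L →ₗ[ℝ] L :=
  (![D.U, D.Z, D.V, D.E] i).subtype ∘ₗ
    DirectSum.component ℝ (Fin 4) (fun i => ![D.U, D.Z, D.V, D.E] i) i ∘ₗ
      (LinearEquiv.ofBijective (DirectSum.coeLinearMap ![D.U, D.Z, D.V, D.E])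
        D.isInternal).symm.toLinearMap

/-- The `𝔘`-component. -/
def projU : L →ₗ[ℝ] L := D.proj 0

/-- The `𝔷'`-component. -/
def projZ : L →ₗ[ℝ] L := D.proj 1

/-- The `𝔈`-component. -/
def projE : L →ₗ[ℝ] L := D.proj 3

end NullSplitting

variable [FiniteDimensional ℝ L]

/-- The operator `x ↦ ad†_x c`, where `ad†_x` is the adjoint of `ad_x` with respect to `B`. -/
def adDagger (B : BilinForm ℝ L) (hB : B.Nondegenerate) (c : L) : L →ₗ[ℝ] L where
  toFun x := B.leftAdjointOfNondegenerate hB (LieAlgebra.ad ℝ L x) c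
  map_add' x y := by
    refine (B.toDual hB).injective (LinearMap.ext fun w => ?_)
    have h := fun φ => B.isAdjointPairLeftAdjointOfNondegenerate hB φ c w
    rw [map_add (B.toDual hB), LinearMap.add_apply]
    simp only [LinearMap.BilinForm.toDual_def, h]
    rw [map_add, LinearMap.add_apply, map_add]
  map_smul' r x := by
    refine (B.toDual hB).injective (LinearMap.ext fun w => ?_)
    have h := fun φ => B.isAdjointPairLeftAdjointOfNondegenerate hB φ c w
    rw [map_smul (B.toDual hB), LinearMap.smul_apply]
    simp only [LinearMap.BilinForm.toDual_def, h]
    rw [map_smul, LinearMap.smul_apply, map_smul, RingHom.id_apply]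

/-- The defining property of `ad†`. -/
theorem adDagger_spec (B : BilinForm ℝ L) (hB : B.Nondegenerate) (c x w : L) :
    B (adDagger B hB c x) w = B c ⁅x, w⁆ :=
  B.isAdjointPairLeftAdjointOfNondegenerate hB (LieAlgebra.ad ℝ L x) c w

namespace NullSplitting

variable {B : BilinForm ℝ L} (D : NullSplitting B)

/-- The operator `y ↦ (ad†_y c)^𝔈` with `c = z₀ + v₀`. It vanishes on the center, so it is the
operator on `𝔙 ⊕ 𝔈` extended by zero. As it maps `𝔈` into `𝔈`, its restriction to `𝔈` is the
endomorphism `J` of `𝔈`, and its powers and its exponential restrict to those of `J`. -/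
def opJ (hB : B.Nondegenerate) (c : L) : L →ₗ[ℝ] L := D.projE ∘ₗ adDagger B hB c

/-- The operator `y ↦ (ad†_y c)^𝔘` with `c = z₀ + v₀`, likewise extended by zero. -/
def opU (hB : B.Nondegenerate) (c : L) : L →ₗ[ℝ] L := D.projU ∘ₗ adDagger B hB c

/-- `𝔈₁ = ker (J : 𝔈 → 𝔈)`. -/
def E₁ (hB : B.Nondegenerate) (c : L) : Submodule ℝ L := D.E ⊓ LinearMap.ker (D.opJ hB c)

/-- `𝔈₂`, the orthogonal complement of `𝔈₁` in `𝔈`. -/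
def E₂ (hB : B.Nondegenerate) (c : L) : Submodule ℝ L := D.E ⊓ B.orthogonal (D.E₁ hB c)

/-- The inverse `J⁻¹ : 𝔈₂ → 𝔈₂` of `J : 𝔈₂ → 𝔈₂` (meaningful when the latter is bijective). -/
def invJ (hB : B.Nondegenerate) (c : L) : L → L :=
  Function.invFunOn (D.opJ hB c) (D.E₂ hB c : Set L)

end NullSplitting

end Algebra

/-! ### Geodesics of a field of bilinear forms on a manifold -/

section Geodesics

variable {E : Type*} [NormedAddCommGroup E] [NormedSpace ℝ E]
  {M : Type*} [TopologicalSpace M] [ChartedSpace E M]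

/-- The coefficients, at the point `x` of the chart around `p` and on the coordinate vectors
`v` and `w`, of the metric tensor `g`. -/
def chartMetric (g : ∀ p : M, BilinForm ℝ (TangentSpace 𝓘(ℝ, E) p)) (p : M) (x v w : E) : ℝ :=
  g ((extChartAt 𝓘(ℝ, E) p).symm x)
    (mfderiv 𝓘(ℝ, E) 𝓘(ℝ, E) (extChartAt 𝓘(ℝ, E) p).symm x v)
    (mfderiv 𝓘(ℝ, E) 𝓘(ℝ, E) (extChartAt 𝓘(ℝ, E) p).symm x w)

/-- The geodesic equation at the time `t`, for a curve `c` in the chart around `p`, paired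
with all coordinate vectors `w`: with the metric coefficients `gᵢⱼ` of that chart and the
Christoffel symbols of the first kind of the Levi-Civita connection, it reads
`gₖₗ c̈ˡ + ½ (∂ᵢ gⱼₖ + ∂ⱼ gᵢₖ - ∂ₖ gᵢⱼ) ċⁱ ċʲ = 0` for all `k`. -/
def GeodesicEquationAt (g : ∀ p : M, BilinForm ℝ (TangentSpace 𝓘(ℝ, E) p)) (p : M)
    (c : ℝ → E) (t : ℝ) : Prop :=
  ∀ w : E,
    chartMetric g p (c t) (deriv (deriv c) t) w
      + fderiv ℝ (fun x => chartMetric g p x (deriv c t) w) (c t) (deriv c t)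
      - (1 / 2 : ℝ) * fderiv ℝ (fun x => chartMetric g p x (deriv c t) (deriv c t)) (c t) w = 0

/-- `γ` is, on the open set `s` of times, a geodesic of `g`: it is twice continuously
differentiable and satisfies the geodesic equation in local coordinates (an equation that does not
depend on the coordinates; at the time `t` those of the preferred chart at `γ t` are used). -/
structure IsGeodesicOn (g : ∀ p : M, BilinForm ℝ (TangentSpace 𝓘(ℝ, E) p)) (γ : ℝ → M)
    (s : Set ℝ) : Prop where
  contMDiffOn : ContMDiffOn 𝓘(ℝ, ℝ) 𝓘(ℝ, E) 2 γ s
  equation : ∀ t ∈ s, GeodesicEquationAt g (γ t) (fun τ => extChartAt 𝓘(ℝ, E) (γ t) (γ τ)) t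

/-- The velocity of the curve `γ` at the time `t`, together with its base point. -/
def velocity (γ : ℝ → M) (t : ℝ) : TangentBundle 𝓘(ℝ, E) M :=
  ⟨γ t, mfderiv 𝓘(ℝ, ℝ) 𝓘(ℝ, E) γ t (1 : ℝ)⟩

/-- Every tangent vector is the initial velocity of a geodesic that is defined for all times. -/
def IsGeodesicallyComplete (g : ∀ p : M, BilinForm ℝ (TangentSpace 𝓘(ℝ, E) p)) : Prop :=
  ∀ ξ : TangentBundle 𝓘(ℝ, E) M, ∃ γ : ℝ → M, IsGeodesicOn g γ Set.univ ∧ velocity γ 0 = ξ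

end Geodesics

/-! ### Lie groups -/

section Groups

/-- A smooth Lie group is smooth enough to have a Lie algebra in the sense of Mathlib. -/
instance lEInfty_minSmoothness_three : ENat.LEInfty (minSmoothness ℝ 3) :=
  ⟨by rw [minSmoothness_of_isRCLikeNormedField]; exact ENat.LEInfty.out⟩

variable {E : Type*} [NormedAddCommGroup E] [NormedSpace ℝ E]
  {N : Type*} [TopologicalSpace N] [ChartedSpace E N] [Group N]

instance [FiniteDimensional ℝ E] : FiniteDimensional ℝ (GroupLieAlgebra 𝓘(ℝ, E) N) :=
  inferInstanceAs (FiniteDimensional ℝ E)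

open Classical in
/-- The exponential map of a Lie group: `exp X` is the value at time `1` of the integral curve,
starting at the identity, of the left-invariant vector field given by `X`. -/
def lieExp (X : GroupLieAlgebra 𝓘(ℝ, E) N) : N :=
  if h : ∃ γ : ℝ → N, γ 0 = 1 ∧
      IsMIntegralCurve (I := 𝓘(ℝ, E)) γ (fun p => mulInvariantVectorField X p)
  then h.choose 1 else 1

/-- The differential at `p` of the left translation by `p⁻¹`, with values in the Lie algebra. -/
def leftTrivialization (p : N) : TangentSpace 𝓘(ℝ, E) p →ₗ[ℝ] GroupLieAlgebra 𝓘(ℝ, E) N :=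
  (mfderiv 𝓘(ℝ, E) 𝓘(ℝ, E) (fun q : N => p⁻¹ * q) p :
    TangentSpace 𝓘(ℝ, E) p →L[ℝ] TangentSpace 𝓘(ℝ, E) (p⁻¹ * p)).toLinearMap

/-- The left-invariant metric tensor on a Lie group induced by an inner product on its Lie
algebra. -/
def leftInvariantMetric (B : BilinForm ℝ (GroupLieAlgebra 𝓘(ℝ, E) N)) (p : N) :
    BilinForm ℝ (TangentSpace 𝓘(ℝ, E) p) :=
  B.comp (leftTrivialization p) (leftTrivialization p)

/-- `∫₀ᵗ f(s) ds` for a curve in the Lie algebra. -/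
def lieIntegral (f : ℝ → GroupLieAlgebra 𝓘(ℝ, E) N) (t : ℝ) : GroupLieAlgebra 𝓘(ℝ, E) N :=
  ((∫ s in (0 : ℝ)..t, (f s : E)) : E)

/-- The exponential `e^T` of an endomorphism of the Lie algebra. -/
def opExp [FiniteDimensional ℝ E]
    (T : GroupLieAlgebra 𝓘(ℝ, E) N →ₗ[ℝ] GroupLieAlgebra 𝓘(ℝ, E) N) :
    GroupLieAlgebra 𝓘(ℝ, E) N →ₗ[ℝ] GroupLieAlgebra 𝓘(ℝ, E) N :=
  ((NormedSpace.exp (LinearMap.toContinuousLinearMap (T : E →ₗ[ℝ] E)) : E →L[ℝ] E) : E →ₗ[ℝ] E)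

/-- The curve `y` in the Lie algebra is the solution, in exponential coordinates, of the geodesic
equations of the metric tensor `g` through the identity with initial velocity `w`: the curve
`exp ∘ y` is a geodesic for all times, with initial velocity `w` at the identity, and both in the
group and in exponential coordinates it is the only one, on every open interval around `0`. -/
structure SolvesGeodesicEquations (g : ∀ p : N, BilinForm ℝ (TangentSpace 𝓘(ℝ, E) p))
    (w : GroupLieAlgebra 𝓘(ℝ, E) N) (y : ℝ → GroupLieAlgebra 𝓘(ℝ, E) N) : Prop where
  contDiff : ContDiff (F := E) ℝ 2 y
  zero : y 0 = 0
  deriv_zero : deriv y 0 = w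
  isGeodesic : IsGeodesicOn g (fun t => lieExp (y t)) Set.univ
  velocity_zero : velocity (fun t => lieExp (y t)) 0 = (⟨1, w⟩ : TangentBundle 𝓘(ℝ, E) N)
  unique : ∀ s : Set ℝ, IsOpen s → IsPreconnected s → (0 : ℝ) ∈ s → ∀ γ : ℝ → N,
    IsGeodesicOn g γ s → velocity γ 0 = (⟨1, w⟩ : TangentBundle 𝓘(ℝ, E) N) →
      ∀ t ∈ s, γ t = lieExp (y t)
  unique_coordinates : ∀ s : Set ℝ, IsOpen s → IsPreconnected s → (0 : ℝ) ∈ s →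
    ∀ y' : ℝ → GroupLieAlgebra 𝓘(ℝ, E) N, ContDiffOn (F := E) ℝ 2 y' s →
      y' 0 = 0 → deriv y' 0 = w → IsGeodesicOn g (fun t => lieExp (y' t)) s →
        ∀ t ∈ s, y' t = y t

variable [LieGroup 𝓘(ℝ, E) ∞ N]

/-- `-½ ∫₀ᵗ [ẋ(s), x(s)] ds`. -/
def bracketIntegral [CompleteSpace E] (x : ℝ → GroupLieAlgebra 𝓘(ℝ, E) N) (t : ℝ) :
    GroupLieAlgebra 𝓘(ℝ, E) N :=
  -(1 / 2 : ℝ) • lieIntegral (fun s => ⁅deriv x s, x s⁆) t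

variable [FiniteDimensional ℝ E] {B : BilinForm ℝ (GroupLieAlgebra 𝓘(ℝ, E) N)}

/-- The curve `x(t) + z(t) + u(t)` in the Lie algebra, where `x` is given and
`z(t) = t z₀ + (-½ ∫₀ᵗ [ẋ, x])^𝔷'`,
`u(t) = t u₀ + (-½ ∫₀ᵗ [ẋ, x])^𝔘 + ∫₀ᵗ ∫₀ˢ (ad†_{ẋ(σ)} (z₀ + v₀))^𝔘 dσ ds`. -/
def geodesicCoordinates (D : NullSplitting B) (hB : B.Nondegenerate)
    (u₀ z₀ v₀ : GroupLieAlgebra 𝓘(ℝ, E) N) (x : ℝ → GroupLieAlgebra 𝓘(ℝ, E) N) (t : ℝ) :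
    GroupLieAlgebra 𝓘(ℝ, E) N :=
  x t + (t • z₀ + D.projZ (bracketIntegral x t))
    + (t • u₀ + D.projU (bracketIntegral x t)
      + lieIntegral (fun s => lieIntegral (fun σ => D.opU hB (z₀ + v₀) (deriv x σ)) s) t)

end Groups

end

/-! Everything is transported to the Lie algebra by the left logarithmic derivative `ξ = γ⁻¹γ̇`. A
curve in the group is determined by `ξ` and one value (`eqOn_of_leftLogDeriv_eq`). By the
Maurer–Cartan equation (`fderiv_leftLogDeriv_sub`), the geodesic equation of a left-invariant metric
is equivalent to the Euler–Arnold equation `⟨ξ̇, w⟩ = ⟨ξ, [ξ, w]⟩` for all `w`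
(`geodesicEquationAt_leftInvariantMetric_iff`).

In the 2-step nilpotent case `⟨ξ, [X, Y]⟩` is conserved, because its derivative is `⟨ξ, [ξ, [X, Y]]⟩
= 0`. Hence `ξ̇ = ad†_ξ ξ(0)` along a solution: a linear equation with constant coefficients
(`hasDerivAt_of_eulerArnold`). This yields uniqueness on every interval and solutions for all times,
hence completeness, which needs no decomposition of the Lie algebra.

The exponential map enters through the Baker–Campbell–Hausdorff formula, obtained from the
Maurer–Cartan equation for `exp(tX) exp(sY)`. It gives the logarithmic derivative of `exp ∘ y` as `ẏ
- ½[y, ẏ]` (`leftLogDeriv_groupExp_comp`). This expression and an initial value determine `y`, so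
uniqueness in coordinates follows without injectivity of the exponential map.

For the explicit solutions, `ad†_x c` is orthogonal to the center and therefore lies in `𝔘 ⊕ 𝔈`. The
Euler–Arnold equation splits accordingly: `ẍ = J ẋ` is the only equation to be solved, and the
central components are quadratures in `x` (`solvesGeodesicEquations_geodesicCoordinates`). The curve
of part 1 has velocity `e^{tJ}(v₀ + e₀)`. For part 2, `J` is skew on `𝔈`, so its image is orthogonal
to its kernel; if `𝔈 = 𝔈₁ ⊕ 𝔈₂` it is bijective on `𝔈₂`, and the inverse there integrates the
exponentials. The bracket integral is verified by differentiation. -/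

set_option linter.unusedSectionVars false

/-! ### Left logarithmic derivatives -/

section LeftLogDeriv

open Filter Topology

variable {E : Type*} [NormedAddCommGroup E] [NormedSpace ℝ E]
  {N : Type*} [TopologicalSpace N] [ChartedSpace E N] [Group N]
  {F : Type*} [NormedAddCommGroup F] [NormedSpace ℝ F]
  {F' : Type*} [NormedAddCommGroup F'] [NormedSpace ℝ F']

variable (E) in
/-- The left logarithmic derivative `f⁻¹ df` of a map from a normed space to a Lie group, with
values in the model space of the Lie algebra. -/
noncomputable def leftLogDeriv (f : F → N) (a : F) : F →L[ℝ] E :=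
  (mfderiv 𝓘(ℝ, E) 𝓘(ℝ, E) (fun q : N => (f a)⁻¹ * q) (f a) : E →L[ℝ] E).comp
    (mfderiv 𝓘(ℝ, F) 𝓘(ℝ, E) f a : F →L[ℝ] E)

theorem leftTrivialization_mfderiv (f : F → N) (a v : F) :
    (leftTrivialization (f a) (mfderiv 𝓘(ℝ, F) 𝓘(ℝ, E) f a v) : GroupLieAlgebra 𝓘(ℝ, E) N) =
      (leftLogDeriv E f a v : E) := rfl

variable [LieGroup 𝓘(ℝ, E) ∞ N]

theorem mdifferentiableAt_const_mul (p q : N) :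
    MDifferentiableAt 𝓘(ℝ, E) 𝓘(ℝ, E) (fun x : N => p * x) q :=
  (contMDiff_mul_left (n := ∞)).contMDiffAt.mdifferentiableAt (by simp)

theorem MDifferentiableAt.lieGroup_mul {f g : F → N} {a : F}
    (hf : MDifferentiableAt 𝓘(ℝ, F) 𝓘(ℝ, E) f a) (hg : MDifferentiableAt 𝓘(ℝ, F) 𝓘(ℝ, E) g a) :
    MDifferentiableAt 𝓘(ℝ, F) 𝓘(ℝ, E) (fun b => f b * g b) a :=
  ((contMDiff_mul 𝓘(ℝ, E) ∞).contMDiffAt.mdifferentiableAt (by simp)).comp a (hf.prodMk hg)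

theorem MDifferentiableAt.lieGroup_inv {f : F → N} {a : F}
    (hf : MDifferentiableAt 𝓘(ℝ, F) 𝓘(ℝ, E) f a) :
    MDifferentiableAt 𝓘(ℝ, F) 𝓘(ℝ, E) (fun b => (f b)⁻¹) a :=
  ((contMDiff_inv 𝓘(ℝ, E) ∞).contMDiffAt.mdifferentiableAt (by simp)).comp a hf

theorem mfderiv_eq_fderiv_extChartAt {f : F → N} {a : F} {p : N} (h : f a = p)
    (hf : MDifferentiableAt 𝓘(ℝ, F) 𝓘(ℝ, E) f a) :
    (mfderiv 𝓘(ℝ, F) 𝓘(ℝ, E) f a : F →L[ℝ] E) =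
      fderiv ℝ (fun b => extChartAt 𝓘(ℝ, E) p (f b)) a := by
  subst h
  refine (if_pos hf).trans ?_
  simp only [writtenInExtChartAt, Function.comp_def, extChartAt_model_space_eq_id,
    PartialEquiv.refl_symm, PartialEquiv.refl_coe, id_eq, modelWithCornersSelf_coe, Set.range_id,
    fderivWithin_univ]
  rfl

/-- Tangent vectors at a point are identified with model vectors through the preferred chart at that
point, so after translation to the identity only an ordinary derivative in the chart at `1` remains.
-/
theorem leftLogDeriv_eq_fderiv {f : F → N} {a : F}
    (hf : MDifferentiableAt 𝓘(ℝ, F) 𝓘(ℝ, E) f a) :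
    leftLogDeriv E f a = fderiv ℝ (fun b => extChartAt 𝓘(ℝ, E) (1 : N) ((f a)⁻¹ * f b)) a := by
  have h1 := mfderiv_comp (I := 𝓘(ℝ, F)) (I' := 𝓘(ℝ, E)) (I'' := 𝓘(ℝ, E)) a
    (mdifferentiableAt_const_mul (f a)⁻¹ (f a)) hf
  have h2 := mfderiv_eq_fderiv_extChartAt (f := (fun q : N => (f a)⁻¹ * q) ∘ f) (a := a) (p := 1)
    (by simp) ((mdifferentiableAt_const_mul (f a)⁻¹ (f a)).comp a hf)
  exact h1.symm.trans h2

theorem leftLogDeriv_mul_left (p : N) {f : F → N} {a : F}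
    (hf : MDifferentiableAt 𝓘(ℝ, F) 𝓘(ℝ, E) f a) :
    leftLogDeriv E (fun b => p * f b) a = leftLogDeriv E f a := by
  rw [leftLogDeriv_eq_fderiv hf]
  refine (leftLogDeriv_eq_fderiv ((mdifferentiableAt_const_mul p (f a)).comp a hf)).trans ?_
  simp [mul_assoc]

theorem leftLogDeriv_comp {f : F → N} {g : F' → F} {a : F'}
    (hf : MDifferentiableAt 𝓘(ℝ, F) 𝓘(ℝ, E) f (g a)) (hg : DifferentiableAt ℝ g a) :
    leftLogDeriv E (f ∘ g) a = (leftLogDeriv E f (g a)).comp (fderiv ℝ g a) := by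
  have := mfderiv_comp (I := 𝓘(ℝ, F')) (I' := 𝓘(ℝ, F)) (I'' := 𝓘(ℝ, E)) a hf
    hg.mdifferentiableAt
  rw [mfderiv_eq_fderiv] at this
  exact congrArg (ContinuousLinearMap.comp
    (mfderiv 𝓘(ℝ, E) 𝓘(ℝ, E) (fun q : N => (f (g a))⁻¹ * q) (f (g a)) : E →L[ℝ] E)) this

/-- The translation varies with the base point. The logarithmic derivative is therefore the partial
derivative in `c` of `φ(f(b)⁻¹ f(c))`, taken along the diagonal, and exactly one order of
differentiability is lost. -/
theorem contDiffAt_leftLogDeriv {f : F → N} {a : F} {n : ℕ}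
    (hf : ContMDiffAt 𝓘(ℝ, F) 𝓘(ℝ, E) (n + 1 : ℕ) f a) :
    ContDiffAt ℝ n (leftLogDeriv E f) a := by
  have hG : ContDiffAt ℝ (n + 1 : ℕ)
      (Function.uncurry fun b c => extChartAt 𝓘(ℝ, E) (1 : N) ((f b)⁻¹ * f c)) (a, a) := by
    rw [← contMDiffAt_iff_contDiffAt]
    have h1 : ContMDiffAt 𝓘(ℝ, F × F) 𝓘(ℝ, E) (n + 1 : ℕ) (fun x : F × F => f x.1) (a, a) :=
      ContMDiffAt.comp (a, a) (g := f) (f := Prod.fst) hf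
        (contMDiffAt_iff_contDiffAt.2 contDiffAt_fst)
    have h2 : ContMDiffAt 𝓘(ℝ, F × F) 𝓘(ℝ, E) (n + 1 : ℕ) (fun x : F × F => f x.2) (a, a) :=
      ContMDiffAt.comp (a, a) (g := f) (f := Prod.snd) hf
        (contMDiffAt_iff_contDiffAt.2 contDiffAt_snd)
    have hle : ((n + 1 : ℕ) : WithTop ℕ∞) ≤ ∞ := by exact_mod_cast le_top
    have := LieGroup.of_le (I := 𝓘(ℝ, E)) (G := N) hle
    have h3 := h1.inv.mul h2
    refine ContMDiffAt.comp (a, a) (g := extChartAt 𝓘(ℝ, E) (1 : N)) ?_ h3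
    have := contMDiffAt_extChartAt (I := 𝓘(ℝ, E)) (n := (n + 1 : ℕ)) (x := (1 : N))
    simpa using this
  have h := ContDiffAt.fderiv (f := fun b c => extChartAt 𝓘(ℝ, E) (1 : N) ((f b)⁻¹ * f c))
    (g := id) (n := (n + 1 : ℕ)) (m := n) hG contDiffAt_id (by simp)
  refine h.congr_of_eventuallyEq ?_
  have hle : IsManifold 𝓘(ℝ, E) (n + 1 : ℕ) N :=
    IsManifold.of_le (n := ∞) (by exact_mod_cast le_top)
  filter_upwards [(contMDiffAt_iff_contMDiffAt_nhds (by exact_mod_cast WithTop.coe_ne_top)).1 hf] with b hb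
  exact leftLogDeriv_eq_fderiv (hb.mdifferentiableAt (by simp))

end LeftLogDeriv

/-! ### Translated coordinates and the product rule -/

section StructureEquation

open Filter Topology VectorField

variable {E : Type*} [NormedAddCommGroup E] [NormedSpace ℝ E]
  {N : Type*} [TopologicalSpace N] [ChartedSpace E N] [Group N] [LieGroup 𝓘(ℝ, E) ∞ N]
  {F : Type*} [NormedAddCommGroup F] [NormedSpace ℝ F]

theorem Filter.EventuallyEq.leftLogDeriv_eq {f g : F → N} {a : F} (h : f =ᶠ[𝓝 a] g) :
    leftLogDeriv E f a = leftLogDeriv E g a := by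
  have h1 := h.mfderiv_eq (I := 𝓘(ℝ, F)) (I' := 𝓘(ℝ, E))
  have h2 := h.self_of_nhds
  unfold leftLogDeriv
  rw [h2]
  exact congrArg (ContinuousLinearMap.comp
    (mfderiv 𝓘(ℝ, E) 𝓘(ℝ, E) (fun q : N => (g a)⁻¹ * q) (g a) : E →L[ℝ] E)) h1

theorem contMDiffAt_extChartAt_symm {p : N} {x : E} {n : WithTop ℕ∞} (hn : n ≤ ∞)
    (hx : x ∈ (extChartAt 𝓘(ℝ, E) p).target) :
    ContMDiffAt 𝓘(ℝ, E) 𝓘(ℝ, E) n (extChartAt 𝓘(ℝ, E) p).symm x := by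
  have : IsManifold 𝓘(ℝ, E) n N := IsManifold.of_le (n := ∞) hn
  exact (contMDiffOn_extChartAt_symm p).contMDiffAt
    ((isOpen_extChartAt_target p).mem_nhds hx)

theorem mdifferentiableAt_extChartAt_symm' {p : N} {x : E}
    (hx : x ∈ (extChartAt 𝓘(ℝ, E) p).target) :
    MDifferentiableAt 𝓘(ℝ, E) 𝓘(ℝ, E) (extChartAt 𝓘(ℝ, E) p).symm x :=
  (contMDiffAt_extChartAt_symm le_rfl hx).mdifferentiableAt (by simp)

variable (E) in
/-- The map `f`, translated so that it maps `a` to the identity and read in the chart there. -/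
noncomputable def translatedCoord (f : F → N) (a b : F) : E :=
  extChartAt 𝓘(ℝ, E) (1 : N) ((f a)⁻¹ * f b)

theorem eventually_eq_mul_translatedCoord {f : F → N} {a : F} (hf : ContinuousAt f a) :
    f =ᶠ[𝓝 a] fun b => f a * (extChartAt 𝓘(ℝ, E) (1 : N)).symm (translatedCoord E f a b) := by
  have : IsTopologicalGroup N := topologicalGroup_of_lieGroup 𝓘(ℝ, E) ∞
  have h1 : ContinuousAt (fun b => (f a)⁻¹ * f b) a := continuousAt_const.mul hf
  have h2 : (extChartAt 𝓘(ℝ, E) (1 : N)).source ∈ 𝓝 ((f a)⁻¹ * f a) := by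
    rw [inv_mul_cancel]
    exact extChartAt_source_mem_nhds 1
  filter_upwards [h1.preimage_mem_nhds h2] with b hb
  rw [translatedCoord, (extChartAt 𝓘(ℝ, E) (1 : N)).left_inv hb, mul_inv_cancel_left]

theorem translatedCoord_self (f : F → N) (a : F) :
    translatedCoord E f a a = extChartAt 𝓘(ℝ, E) (1 : N) 1 := by
  simp [translatedCoord]

theorem contMDiffAt_translatedCoord {f : F → N} {a : F} {n : WithTop ℕ∞} (hn : n ≤ ∞)
    (hf : ContMDiffAt 𝓘(ℝ, F) 𝓘(ℝ, E) n f a) :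
    ContDiffAt ℝ n (translatedCoord E f a) a := by
  have := LieGroup.of_le (I := 𝓘(ℝ, E)) (G := N) hn
  rw [← contMDiffAt_iff_contDiffAt]
  refine ContMDiffAt.comp a (g := extChartAt 𝓘(ℝ, E) (1 : N)) ?_
    ((contMDiff_mul_left (a := (f a)⁻¹)).contMDiffAt.comp a hf)
  have := contMDiffAt_extChartAt (I := 𝓘(ℝ, E)) (n := n) (x := (1 : N))
  simpa using this

theorem differentiableAt_translatedCoord {f : F → N} {a : F}
    (hf : MDifferentiableAt 𝓘(ℝ, F) 𝓘(ℝ, E) f a) :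
    DifferentiableAt ℝ (translatedCoord E f a) a := by
  rw [← mdifferentiableAt_iff_differentiableAt]
  refine MDifferentiableAt.comp a (g := extChartAt 𝓘(ℝ, E) (1 : N)) ?_
    ((mdifferentiableAt_const_mul (f a)⁻¹ (f a)).comp a hf)
  have := (contMDiffAt_extChartAt (I := 𝓘(ℝ, E)) (n := ∞) (x := (1 : N))).mdifferentiableAt
    (by simp)
  simpa using this

theorem leftLogDeriv_extChartAt_symm_one :
    leftLogDeriv E (extChartAt 𝓘(ℝ, E) (1 : N)).symm (extChartAt 𝓘(ℝ, E) (1 : N) 1) =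
      ContinuousLinearMap.id ℝ E := by
  rw [leftLogDeriv_eq_fderiv (mdifferentiableAt_extChartAt_symm' (mem_extChartAt_target 1))]
  rw [extChartAt_to_inv, inv_one]
  have : (fun b => extChartAt 𝓘(ℝ, E) (1 : N) (1 * (extChartAt 𝓘(ℝ, E) (1 : N)).symm b))
      =ᶠ[𝓝 (extChartAt 𝓘(ℝ, E) (1 : N) 1)] id := by
    filter_upwards [extChartAt_target_mem_nhds (I := 𝓘(ℝ, E)) (1 : N)] with b hb
    rw [one_mul, (extChartAt 𝓘(ℝ, E) (1 : N)).right_inv hb, id]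
  rw [this.fderiv_eq, fderiv_id]

/-- The left logarithmic derivative of the map `x ↦ x g`, at the identity: the adjoint action of
`g⁻¹`. -/
noncomputable def adjointInv (g : N) : E →L[ℝ] E :=
  leftLogDeriv E (fun x => (extChartAt 𝓘(ℝ, E) (1 : N)).symm x * g)
    (extChartAt 𝓘(ℝ, E) (1 : N) 1)

/-- Up to left translation, `f g` is the fixed map `P(x, y) = φ⁻¹(x) g(a) φ⁻¹(y)` applied to the
translated coordinates of `f` and `g`. The derivative of `P` is the sum of its two partial
derivatives: the adjoint action of `g(a)⁻¹` and the identity. -/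
theorem leftLogDeriv_mul {f g : F → N} {a : F} (hf : MDifferentiableAt 𝓘(ℝ, F) 𝓘(ℝ, E) f a)
    (hg : MDifferentiableAt 𝓘(ℝ, F) 𝓘(ℝ, E) g a) :
    leftLogDeriv E (fun b => f b * g b) a =
      (adjointInv (g a)).comp (leftLogDeriv E f a) + leftLogDeriv E g a := by
  set φ := extChartAt 𝓘(ℝ, E) (1 : N) with hφ
  set o := φ 1 with ho
  have hmo : MDifferentiableAt 𝓘(ℝ, E) 𝓘(ℝ, E) φ.symm o :=
    mdifferentiableAt_extChartAt_symm' (mem_extChartAt_target 1)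
  have hso : φ.symm o = 1 := extChartAt_to_inv 1
  let P : E × E → N := fun x => φ.symm x.1 * (g a * φ.symm x.2)
  have hP : MDifferentiableAt 𝓘(ℝ, E × E) 𝓘(ℝ, E) P (o, o) := by
    have h1 : MDifferentiableAt 𝓘(ℝ, E × E) 𝓘(ℝ, E) (fun x : E × E => φ.symm x.1) (o, o) :=
      MDifferentiableAt.comp (o, o) (g := φ.symm) (f := Prod.fst) hmo
        differentiableAt_fst.mdifferentiableAt
    have h2 : MDifferentiableAt 𝓘(ℝ, E × E) 𝓘(ℝ, E) (fun x : E × E => φ.symm x.2) (o, o) :=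
      MDifferentiableAt.comp (o, o) (g := φ.symm) (f := Prod.snd) hmo
        differentiableAt_snd.mdifferentiableAt
    have h3 := MDifferentiableAt.comp (o, o) (mdifferentiableAt_const_mul (E := E) (g a) _) h2
    exact h1.lieGroup_mul h3
  have hfg : (fun b => f b * g b) =ᶠ[𝓝 a]
      fun b => f a * (P ∘ fun b => (translatedCoord E f a b, translatedCoord E g a b)) b := by
    filter_upwards [eventually_eq_mul_translatedCoord (E := E) hf.continuousAt,
      eventually_eq_mul_translatedCoord (E := E) hg.continuousAt] with b h1 h2
    conv_lhs => rw [h1, h2]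
    simp [P, mul_assoc, hφ]
  have hd : HasFDerivAt (fun b => (translatedCoord E f a b, translatedCoord E g a b))
      ((leftLogDeriv E f a).prod (leftLogDeriv E g a)) a := by
    have h1 := (differentiableAt_translatedCoord hf).hasFDerivAt
    have h2 := (differentiableAt_translatedCoord hg).hasFDerivAt
    rw [leftLogDeriv_eq_fderiv hf, leftLogDeriv_eq_fderiv hg]
    exact h1.prodMk h2
  have hP' : MDifferentiableAt 𝓘(ℝ, E × E) 𝓘(ℝ, E) P
      (translatedCoord E f a a, translatedCoord E g a a) := by
    rw [translatedCoord_self, translatedCoord_self]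
    exact hP
  have hcomp := MDifferentiableAt.comp a hP' hd.differentiableAt.mdifferentiableAt
  rw [hfg.leftLogDeriv_eq, leftLogDeriv_mul_left _ hcomp,
    leftLogDeriv_comp (g := fun b => (translatedCoord E f a b, translatedCoord E g a b))
      hP' hd.differentiableAt, hd.fderiv, translatedCoord_self,
    translatedCoord_self]
  have e1 : (leftLogDeriv E P (o, o)).comp (ContinuousLinearMap.inl ℝ E E) = adjointInv (g a) := by
    have hd1 : HasFDerivAt (fun x : E => (x, o)) (ContinuousLinearMap.inl ℝ E E) o :=
      hasFDerivAt_prodMk_left o o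
    have := leftLogDeriv_comp (g := fun x : E => (x, o)) (a := o) hP hd1.differentiableAt
    rw [hd1.fderiv] at this
    rw [← this, adjointInv]
    congr 1
    ext x
    simp only [P, Function.comp_apply, hso, mul_one]
    rfl
  have e2 : (leftLogDeriv E P (o, o)).comp (ContinuousLinearMap.inr ℝ E E) =
      ContinuousLinearMap.id ℝ E := by
    have hd1 : HasFDerivAt (fun x : E => (o, x)) (ContinuousLinearMap.inr ℝ E E) o :=
      hasFDerivAt_prodMk_right o o
    have := leftLogDeriv_comp (g := fun x : E => (o, x)) (a := o) hP hd1.differentiableAt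
    rw [hd1.fderiv] at this
    rw [← this, ← leftLogDeriv_extChartAt_symm_one (N := N), ← leftLogDeriv_mul_left (g a) hmo]
    congr 1
    ext x
    simp only [P, Function.comp_apply, hso, one_mul]
  rw [← e1]
  ext v
  have e3 := congrArg (fun T : E →L[ℝ] E => T (leftLogDeriv E g a v)) e2
  simp only [ContinuousLinearMap.comp_apply, ContinuousLinearMap.id_apply] at e3
  simp only [ContinuousLinearMap.comp_apply, _root_.add_apply]
  conv_rhs => rw [← e3]
  rw [← map_add]
  simp
  rfl

end StructureEquation

/-! ### Left-invariant vector fields in the chart at the identity -/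

section MaurerCartan

open Filter Topology VectorField

variable {E : Type*} [NormedAddCommGroup E] [NormedSpace ℝ E]
  {N : Type*} [TopologicalSpace N] [ChartedSpace E N] [Group N] [LieGroup 𝓘(ℝ, E) ∞ N]
  {F : Type*} [NormedAddCommGroup F] [NormedSpace ℝ F]

theorem eventually_translatedCoord_mem_target {f : F → N} {a : F} (hf : ContinuousAt f a) :
    ∀ᶠ b in 𝓝 a, (f a)⁻¹ * f b ∈ (extChartAt 𝓘(ℝ, E) (1 : N)).source := by
  have : IsTopologicalGroup N := topologicalGroup_of_lieGroup 𝓘(ℝ, E) ∞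
  have h1 : ContinuousAt (fun b => (f a)⁻¹ * f b) a := continuousAt_const.mul hf
  refine h1.preimage_mem_nhds ?_
  rw [inv_mul_cancel]
  exact extChartAt_source_mem_nhds 1

theorem eventually_differentiableAt_translatedCoord {f : F → N} {a : F}
    (hf : ∀ᶠ b in 𝓝 a, MDifferentiableAt 𝓘(ℝ, F) 𝓘(ℝ, E) f b) :
    ∀ᶠ b in 𝓝 a, DifferentiableAt ℝ (translatedCoord E f a) b := by
  have : IsManifold 𝓘(ℝ, E) 1 N := IsManifold.of_le (n := ∞) ENat.LEInfty.out
  filter_upwards [hf, eventually_translatedCoord_mem_target (E := E) hf.self_of_nhds.continuousAt]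
    with b h1 h2
  rw [← mdifferentiableAt_iff_differentiableAt]
  rw [extChartAt_source] at h2
  exact MDifferentiableAt.comp b (g := extChartAt 𝓘(ℝ, E) (1 : N))
    (mdifferentiableAt_extChartAt h2) ((mdifferentiableAt_const_mul (f a)⁻¹ (f b)).comp b h1)

/-- Left translation by the constant `f(a)` is invisible to the logarithmic derivative, so near `a`
it is the Maurer–Cartan form of the chart at `1`, pulled back by the translated coordinate. -/
theorem leftLogDeriv_eventually_eq_comp {f : F → N} {a : F}
    (hf : ∀ᶠ b in 𝓝 a, MDifferentiableAt 𝓘(ℝ, F) 𝓘(ℝ, E) f b) :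
    ∀ᶠ b in 𝓝 a, leftLogDeriv E f b =
      (leftLogDeriv E (extChartAt 𝓘(ℝ, E) (1 : N)).symm (translatedCoord E f a b)).comp
        (fderiv ℝ (translatedCoord E f a) b) := by
  filter_upwards [(eventually_eq_mul_translatedCoord (E := E)
    hf.self_of_nhds.continuousAt).eventuallyEq_nhds,
    eventually_translatedCoord_mem_target (E := E) hf.self_of_nhds.continuousAt,
    eventually_differentiableAt_translatedCoord hf] with b h2 h3 h6
  have h5 : MDifferentiableAt 𝓘(ℝ, E) 𝓘(ℝ, E) (extChartAt 𝓘(ℝ, E) (1 : N)).symm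
      (translatedCoord E f a b) :=
    mdifferentiableAt_extChartAt_symm' ((extChartAt 𝓘(ℝ, E) (1 : N)).map_source h3)
  rw [h2.leftLogDeriv_eq, ← leftLogDeriv_comp h5 h6]
  exact leftLogDeriv_mul_left _ (h5.comp b h6.mdifferentiableAt)

theorem mfderiv_extChartAt_one :
    (mfderiv 𝓘(ℝ, E) 𝓘(ℝ, E) (extChartAt 𝓘(ℝ, E) (1 : N)) (1 : N) : E →L[ℝ] E) =
      ContinuousLinearMap.id ℝ E := by
  have h : MDifferentiableAt 𝓘(ℝ, E) 𝓘(ℝ, E) (extChartAt 𝓘(ℝ, E) (1 : N)) (1 : N) :=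
    (contMDiffAt_extChartAt (I := 𝓘(ℝ, E)) (n := ∞) (x := (1 : N))).mdifferentiableAt (by simp)
  refine (if_pos h).trans ?_
  simp only [writtenInExtChartAt, extChartAt_model_space_eq_id,
    PartialEquiv.refl_coe, modelWithCornersSelf_coe, Set.range_id, fderivWithin_univ]
  have : (id ∘ extChartAt 𝓘(ℝ, E) (1 : N) ∘ (extChartAt 𝓘(ℝ, E) (1 : N)).symm)
      =ᶠ[𝓝 (extChartAt 𝓘(ℝ, E) (1 : N) 1)] id := by
    filter_upwards [extChartAt_target_mem_nhds (I := 𝓘(ℝ, E)) (1 : N)] with b hb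
    simp only [Function.comp_apply, (extChartAt 𝓘(ℝ, E) (1 : N)).right_inv hb, id]
  exact this.fderiv_eq.trans fderiv_id

theorem leftTrivialization_mulInvariantVectorField (X : GroupLieAlgebra 𝓘(ℝ, E) N) (q : N) :
    leftTrivialization q (mulInvariantVectorField X q) = X := by
  have h1 := mfderiv_comp (I := 𝓘(ℝ, E)) (I' := 𝓘(ℝ, E)) (I'' := 𝓘(ℝ, E)) (1 : N)
    (mdifferentiableAt_const_mul (q)⁻¹ (q * 1)) (mdifferentiableAt_const_mul q (1 : N))
  have h2 : (fun p => q⁻¹ * p) ∘ (fun p => q * p) = (id : N → N) := by ext; simp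
  rw [h2, mfderiv_id] at h1
  have h3 := congrArg (fun T : E →L[ℝ] E => T X) h1
  refine Eq.trans ?_ h3.symm
  change (mfderiv 𝓘(ℝ, E) 𝓘(ℝ, E) (fun p : N => q⁻¹ * p) q : E →L[ℝ] E)
    ((mfderiv 𝓘(ℝ, E) 𝓘(ℝ, E) (fun p : N => q * p) 1 : E →L[ℝ] E) X) =
     (mfderiv 𝓘(ℝ, E) 𝓘(ℝ, E) (fun p : N => q⁻¹ * p) (q * 1) : E →L[ℝ] E)
    ((mfderiv 𝓘(ℝ, E) 𝓘(ℝ, E) (fun p : N => q * p) 1 : E →L[ℝ] E) X)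
  rw [mul_one]

theorem isInvertible_mfderiv_extChartAt_symm_one {x : E}
    (hx : x ∈ (extChartAt 𝓘(ℝ, E) (1 : N)).target) :
    (mfderiv 𝓘(ℝ, E) 𝓘(ℝ, E) (extChartAt 𝓘(ℝ, E) (1 : N)).symm x).IsInvertible := by
  have : IsManifold 𝓘(ℝ, E) 1 N := IsManifold.of_le (n := ∞) (by exact_mod_cast le_top)
  have := isInvertible_mfderivWithin_extChartAt_symm hx
  simpa using this

theorem leftLogDeriv_extChartAt_symm_pullback {x : E}
    (hx : x ∈ (extChartAt 𝓘(ℝ, E) (1 : N)).target) (X : GroupLieAlgebra 𝓘(ℝ, E) N) :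
    leftLogDeriv E (extChartAt 𝓘(ℝ, E) (1 : N)).symm x
      (mpullbackWithin 𝓘(ℝ, E) 𝓘(ℝ, E) (extChartAt 𝓘(ℝ, E) (1 : N)).symm
        (mulInvariantVectorField X) (Set.range 𝓘(ℝ, E)) x : E) = X := by
  have h1 : mpullbackWithin 𝓘(ℝ, E) 𝓘(ℝ, E) (extChartAt 𝓘(ℝ, E) (1 : N)).symm
        (mulInvariantVectorField X) (Set.range 𝓘(ℝ, E)) x =
      (mfderiv 𝓘(ℝ, E) 𝓘(ℝ, E) (extChartAt 𝓘(ℝ, E) (1 : N)).symm x).inverse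
        (mulInvariantVectorField X ((extChartAt 𝓘(ℝ, E) (1 : N)).symm x)) := by
    rw [mpullbackWithin_apply]
    simp only [modelWithCornersSelf_coe, Set.range_id, mfderivWithin_univ]
  rw [h1]
  refine Eq.trans ?_ (leftTrivialization_mulInvariantVectorField X
    ((extChartAt 𝓘(ℝ, E) (1 : N)).symm x))
  refine (leftTrivialization_mfderiv (E := E) (extChartAt 𝓘(ℝ, E) (1 : N)).symm x _).symm.trans ?_
  congr 1
  exact (isInvertible_mfderiv_extChartAt_symm_one hx).self_apply_inverse _

end MaurerCartan

/-! ### The Maurer–Cartan equation -/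

section MaurerCartan

open Filter Topology VectorField

variable {E : Type*} [NormedAddCommGroup E] [NormedSpace ℝ E] [FiniteDimensional ℝ E]
  {N : Type*} [TopologicalSpace N] [ChartedSpace E N] [Group N] [LieGroup 𝓘(ℝ, E) ∞ N]
  {F : Type*} [NormedAddCommGroup F] [NormedSpace ℝ F]

variable (E N) in
/-- The bracket of the Lie algebra of `N`, as a bilinear map. -/
noncomputable def groupBracketLinear : GroupLieAlgebra 𝓘(ℝ, E) N →ₗ[ℝ]
    GroupLieAlgebra 𝓘(ℝ, E) N →ₗ[ℝ] GroupLieAlgebra 𝓘(ℝ, E) N :=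
  LinearMap.mk₂ ℝ (fun X Y => ⁅X, Y⁆) add_lie smul_lie lie_add fun c X Y => lie_smul c X Y

variable (E N) in
/-- The bracket of the Lie algebra of `N`, as a continuous bilinear map on the model space. -/
noncomputable def groupBracket : E →L[ℝ] E →L[ℝ] E :=
  LinearMap.toContinuousBilinearMap (E := E) (F := E) (G := E) (groupBracketLinear E N)

theorem groupBracket_self (X : E) : groupBracket E N X X = 0 :=
  lie_self (L := GroupLieAlgebra 𝓘(ℝ, E) N) X

theorem groupBracket_skew (X Y : E) : groupBracket E N X Y = -groupBracket E N Y X :=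
  (lie_skew (L := GroupLieAlgebra 𝓘(ℝ, E) N) X Y).symm

theorem eventually_eq_inverse {A : F → E →L[ℝ] E} {v : F → E} {w : F → E} {a : F}
    (hA : ContinuousAt A a) (hinv : (A a).IsInvertible) (h : ∀ᶠ b in 𝓝 a, A b (v b) = w b) :
    ∀ᶠ b in 𝓝 a, v b = (A b).inverse (w b) := by
  have : CompleteSpace E := FiniteDimensional.complete ℝ E
  obtain ⟨e, he⟩ := hinv
  have h1 : ∀ᶠ b in 𝓝 a, A b ∈ Set.range ((↑) : (E ≃L[ℝ] E) → E →L[ℝ] E) :=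
    hA.preimage_mem_nhds (he ▸ ContinuousLinearEquiv.nhds e)
  filter_upwards [h, h1] with b h2 ⟨e', h3⟩
  rw [← h2, ← h3, ContinuousLinearMap.inverse_equiv]
  simp

/-- This is the Maurer–Cartan equation at the identity. The left-invariant fields `V X`, read in the
chart, satisfy `A (V X) = X`; differentiating at a point where `A` is the identity gives `D(V X) u =
-(DA u) X`. The bracket of the Lie algebra is by definition the bracket of these fields there. -/
theorem hasFDerivAt_leftLogDeriv_extChartAt_symm_one (v w : E) :
    fderiv ℝ (leftLogDeriv E (extChartAt 𝓘(ℝ, E) (1 : N)).symm) (extChartAt 𝓘(ℝ, E) (1 : N) 1) v w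
      - fderiv ℝ (leftLogDeriv E (extChartAt 𝓘(ℝ, E) (1 : N)).symm)
        (extChartAt 𝓘(ℝ, E) (1 : N) 1) w v = -groupBracket E N v w := by
  have : CompleteSpace E := FiniteDimensional.complete ℝ E
  set φ := extChartAt 𝓘(ℝ, E) (1 : N) with hφ
  set o := φ 1 with ho
  set A := leftLogDeriv E φ.symm with hA
  have hAo : A o = ContinuousLinearMap.id ℝ E := leftLogDeriv_extChartAt_symm_one
  have hAd : ContDiffAt ℝ 1 A o :=
    contDiffAt_leftLogDeriv (n := 1) (contMDiffAt_extChartAt_symm ENat.LEInfty.out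
      (mem_extChartAt_target 1))
  have hinv : (A o).IsInvertible := hAo ▸ ⟨ContinuousLinearEquiv.refl ℝ E, rfl⟩
  let V : E → E → E := fun X => mpullbackWithin 𝓘(ℝ, E) 𝓘(ℝ, E) φ.symm
    (mulInvariantVectorField (X : GroupLieAlgebra 𝓘(ℝ, E) N)) (Set.range 𝓘(ℝ, E))
  have hV : ∀ X, ∀ᶠ x in 𝓝 o, A x (V X x) = X := by
    intro X
    filter_upwards [extChartAt_target_mem_nhds (I := 𝓘(ℝ, E)) (1 : N)] with x hx
    exact leftLogDeriv_extChartAt_symm_pullback hx X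
  have hVo : ∀ X, V X o = X := by
    intro X
    have := (hV X).self_of_nhds
    rwa [hAo] at this
  have hVd : ∀ X, DifferentiableAt ℝ (V X) o := by
    intro X
    have h1 : V X =ᶠ[𝓝 o] fun x => (A x).inverse X :=
      eventually_eq_inverse hAd.continuousAt hinv (hV X)
    refine DifferentiableAt.congr_of_eventuallyEq ?_ h1
    obtain ⟨e, he⟩ := hinv
    have h2 : DifferentiableAt ℝ ContinuousLinearMap.inverse (A o) :=
      (he ▸ contDiffAt_map_inverse (𝕜 := ℝ) (n := 1) e :
        ContDiffAt ℝ 1 ContinuousLinearMap.inverse (A o)).differentiableAt (by simp)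
    exact (h2.comp o (hAd.differentiableAt (by simp))).clm_apply (differentiableAt_const X)
  have hVf : ∀ X u, fderiv ℝ (V X) o u = -fderiv ℝ A o u X := by
    intro X u
    have h1 : HasFDerivAt (fun x => A x (V X x)) _ o :=
      (hAd.differentiableAt (by simp)).hasFDerivAt.clm_apply (hVd X).hasFDerivAt
    have h2 : HasFDerivAt (fun x => A x (V X x)) (0 : E →L[ℝ] E) o :=
      (hasFDerivAt_const X o).congr_of_eventuallyEq (hV X)
    have h3 := congrArg (fun T : E →L[ℝ] E => T u) (h1.unique h2)
    simp [hAo, hVo] at h3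
    exact eq_neg_of_add_eq_zero_left h3
  have hbr : groupBracket E N v w = fderiv ℝ (V w) o v - fderiv ℝ (V v) o w := by
    let lb : E := lieBracketWithin ℝ (V v) (V w) (φ.symm ⁻¹' Set.univ ∩ Set.range 𝓘(ℝ, E)) o
    -- The manifold bracket at `1` is the bracket in the chart, transported back by the inverse
    -- derivative of the chart, which is the identity.
    have h1 : groupBracket E N v w =
      (mfderiv 𝓘(ℝ, E) 𝓘(ℝ, E) φ (1 : N) : E →L[ℝ] E).inverse lb := rfl
    have h2 : (mfderiv 𝓘(ℝ, E) 𝓘(ℝ, E) φ (1 : N) : E →L[ℝ] E).inverse =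
        ContinuousLinearMap.id ℝ E :=
      (congrArg (ContinuousLinearMap.inverse (R := ℝ) (M := E) (M₂ := E))
        (mfderiv_extChartAt_one (N := N))).trans ContinuousLinearMap.inverse_id
    refine h1.trans ?_
    refine (congrArg (fun T : E →L[ℝ] E => T lb) h2).trans ?_
    simp [lb, lieBracketWithin, hVo]
  rw [hbr, hVf, hVf]
  abel

theorem ContMDiffAt.eventually_mdifferentiableAt {f : F → N} {a : F} {n : ℕ} (hn : n ≠ 0)
    (hf : ContMDiffAt 𝓘(ℝ, F) 𝓘(ℝ, E) n f a) :
    ∀ᶠ b in 𝓝 a, MDifferentiableAt 𝓘(ℝ, F) 𝓘(ℝ, E) f b := by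
  have : IsManifold 𝓘(ℝ, E) n N := IsManifold.of_le (n := ∞) ENat.LEInfty.out
  filter_upwards [(contMDiffAt_iff_contMDiffAt_nhds
    (by exact_mod_cast WithTop.coe_ne_top)).1 hf] with b hb
  exact hb.mdifferentiableAt (by exact_mod_cast hn)

/-- The Maurer–Cartan equation for a map to a Lie group. -/
theorem fderiv_leftLogDeriv_sub {f : F → N} {a : F}
    (hf : ContMDiffAt 𝓘(ℝ, F) 𝓘(ℝ, E) 2 f a) (v w : F) :
    fderiv ℝ (leftLogDeriv E f) a v w - fderiv ℝ (leftLogDeriv E f) a w v =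
      -groupBracket E N (leftLogDeriv E f a v) (leftLogDeriv E f a w) := by
  have hf1 := ContMDiffAt.eventually_mdifferentiableAt two_ne_zero hf
  have hc := contMDiffAt_translatedCoord ENat.LEInfty.out hf
  set φ := extChartAt 𝓘(ℝ, E) (1 : N) with hφ
  set c := translatedCoord E f a with hcdef
  have hca : c a = φ 1 := translatedCoord_self f a
  set A := leftLogDeriv E φ.symm with hA
  have hAo : A (c a) = ContinuousLinearMap.id ℝ E := by
    rw [hca]; exact leftLogDeriv_extChartAt_symm_one
  have hAd : DifferentiableAt ℝ A (c a) := by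
    rw [hca]
    exact (contDiffAt_leftLogDeriv (n := 1) (contMDiffAt_extChartAt_symm ENat.LEInfty.out
      (mem_extChartAt_target 1))).differentiableAt (by simp)
  have hev := leftLogDeriv_eventually_eq_comp hf1
  have hω : leftLogDeriv E f a = fderiv ℝ c a := by
    rw [hev.self_of_nhds]
    change (A (c a)).comp _ = _
    rw [hAo, ContinuousLinearMap.id_comp]
  have hcd := hc.differentiableAt (by simp)
  have hcd2 : DifferentiableAt ℝ (fderiv ℝ c) a :=
    (hc.fderiv_right (m := 1) (by norm_num)).differentiableAt (by simp)
  have h1 : HasFDerivAt (leftLogDeriv E f) _ a :=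
    ((hAd.hasFDerivAt.comp a hcd.hasFDerivAt).clm_comp hcd2.hasFDerivAt).congr_of_eventuallyEq hev
  -- Differentiating `A(c) ∘ Dc` also produces the second derivative of `c`; being symmetric, it
  -- cancels in the antisymmetrization.
  have hsymm : fderiv ℝ (fderiv ℝ c) a v w = fderiv ℝ (fderiv ℝ c) a w v :=
    (hc.isSymmSndFDerivAt (by simp)).eq v w
  have hMC := hasFDerivAt_leftLogDeriv_extChartAt_symm_one (N := N) (fderiv ℝ c a v) (fderiv ℝ c a w)
  rw [h1.fderiv, hω]
  refine Eq.trans ?_ hMC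
  change _ = fderiv ℝ A (φ 1) (fderiv ℝ c a v) (fderiv ℝ c a w) -
    fderiv ℝ A (φ 1) (fderiv ℝ c a w) (fderiv ℝ c a v)
  rw [← hca]
  simp [hsymm]

end MaurerCartan

/-! ### Curves and their logarithmic derivatives -/

section Curves

open Filter Topology

variable {E : Type*} [NormedAddCommGroup E] [NormedSpace ℝ E] [FiniteDimensional ℝ E]
  {N : Type*} [TopologicalSpace N] [ChartedSpace E N] [Group N] [LieGroup 𝓘(ℝ, E) ∞ N]

theorem isInvertible_leftLogDeriv_translatedCoord (f : ℝ → N) (a : ℝ) :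
    (leftLogDeriv E (extChartAt 𝓘(ℝ, E) (1 : N)).symm (translatedCoord E f a a)).IsInvertible := by
  rw [translatedCoord_self, leftLogDeriv_extChartAt_symm_one]
  exact ⟨ContinuousLinearEquiv.refl ℝ E, rfl⟩

theorem contDiffAt_leftLogDeriv_translatedCoord (f : ℝ → N) (a : ℝ) (n : ℕ) :
    ContDiffAt ℝ n (leftLogDeriv E (extChartAt 𝓘(ℝ, E) (1 : N)).symm)
      (translatedCoord E f a a) := by
  rw [translatedCoord_self]
  exact contDiffAt_leftLogDeriv (contMDiffAt_extChartAt_symm ENat.LEInfty.out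
    (mem_extChartAt_target 1))

theorem eventually_deriv_translatedCoord {γ : ℝ → N} {t₀ : ℝ}
    (hγ : ∀ᶠ t in 𝓝 t₀, MDifferentiableAt 𝓘(ℝ, ℝ) 𝓘(ℝ, E) γ t) :
    ∀ᶠ t in 𝓝 t₀, deriv (translatedCoord E γ t₀) t =
      (leftLogDeriv E (extChartAt 𝓘(ℝ, E) (1 : N)).symm (translatedCoord E γ t₀ t)).inverse
        (leftLogDeriv E γ t 1) := by
  refine eventually_eq_inverse (A := fun t => leftLogDeriv E (extChartAt 𝓘(ℝ, E) (1 : N)).symm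
    (translatedCoord E γ t₀ t)) ?_ (isInvertible_leftLogDeriv_translatedCoord γ t₀) ?_
  · exact ContinuousAt.comp (contDiffAt_leftLogDeriv_translatedCoord γ t₀ 0).continuousAt
      (differentiableAt_translatedCoord hγ.self_of_nhds).continuousAt
  · filter_upwards [leftLogDeriv_eventually_eq_comp hγ] with t ht
    rw [ht]
    simp

/-- A curve in a Lie group is as smooth as its left logarithmic derivative, and once more. -/
theorem contMDiffAt_succ_of_leftLogDeriv {γ : ℝ → N} {t₀ : ℝ} {n : ℕ}
    (hγ : ∀ᶠ t in 𝓝 t₀, MDifferentiableAt 𝓘(ℝ, ℝ) 𝓘(ℝ, E) γ t)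
    (hξ : ContDiffAt ℝ n (fun t => leftLogDeriv E γ t 1) t₀) :
    ContMDiffAt 𝓘(ℝ, ℝ) 𝓘(ℝ, E) (n + 1 : ℕ) γ t₀ := by
  set c := translatedCoord E γ t₀ with hc
  have hcd := eventually_differentiableAt_translatedCoord hγ
  have hder := eventually_deriv_translatedCoord hγ
  -- Bootstrapping: `ċ = A(c)⁻¹ ξ` is as smooth as `c`, up to the order of smoothness of `ξ`, so `c`
  -- gains one order at each step.
  have key : ∀ k : ℕ, k ≤ n + 1 → ContDiffAt ℝ k c t₀ := by
    intro k
    induction k with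
    | zero =>
      intro _
      exact contDiffAt_zero.2 ⟨_, hcd, fun t ht =>
        DifferentiableAt.continuousAt ht |>.continuousWithinAt⟩
    | succ k ih =>
      intro hk
      have ihk := ih (by omega)
      have h1 : ContDiffAt ℝ k (deriv c) t₀ := by
        refine ContDiffAt.congr_of_eventuallyEq ?_ hder
        obtain ⟨e, he⟩ := isInvertible_leftLogDeriv_translatedCoord (E := E) γ t₀
        have h2 : ContDiffAt ℝ k ContinuousLinearMap.inverse
            (leftLogDeriv E (extChartAt 𝓘(ℝ, E) (1 : N)).symm (c t₀)) :=
          he ▸ contDiffAt_map_inverse e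
        have h3 : ContDiffAt ℝ k (fun t => leftLogDeriv E (extChartAt 𝓘(ℝ, E) (1 : N)).symm (c t))
            t₀ := (contDiffAt_leftLogDeriv_translatedCoord γ t₀ k).comp t₀ ihk
        exact (h2.comp t₀ h3).clm_apply (hξ.of_le (by exact_mod_cast (by omega : k ≤ n)))
      rw [Nat.cast_succ]
      refine contDiffAt_succ_iff_hasFDerivAt.2
        ⟨fun t => ContinuousLinearMap.toSpanSingleton ℝ (deriv c t), ⟨_, hcd, fun t ht => ?_⟩, ?_⟩
      · exact (DifferentiableAt.hasDerivAt ht).hasFDerivAt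
      · exact (ContinuousLinearMap.toSpanSingletonCLE (𝕜 := ℝ) (E := E)).contDiff.contDiffAt.comp
          t₀ h1
  have hle : ((n + 1 : ℕ) : WithTop ℕ∞) ≤ ∞ := ENat.LEInfty.out
  have := LieGroup.of_le (I := 𝓘(ℝ, E)) (G := N) hle
  refine ContMDiffAt.congr_of_eventuallyEq ?_
    (eventually_eq_mul_translatedCoord (E := E) hγ.self_of_nhds.continuousAt)
  have h1 : ContMDiffAt 𝓘(ℝ, E) 𝓘(ℝ, E) (n + 1 : ℕ) (extChartAt 𝓘(ℝ, E) (1 : N)).symm (c t₀) := by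
    rw [hc, translatedCoord_self]
    exact contMDiffAt_extChartAt_symm hle (mem_extChartAt_target 1)
  exact (contMDiff_mul_left (a := γ t₀)).contMDiffAt.comp t₀
    (h1.comp t₀ (contMDiffAt_iff_contDiffAt.2 (key _ le_rfl)))

theorem leftLogDeriv_const (p : N) (t : ℝ) : leftLogDeriv E (fun _ : ℝ => p) t = 0 := by
  rw [leftLogDeriv_eq_fderiv mdifferentiableAt_const]
  simp

theorem eventually_eq_of_leftLogDeriv_eq_zero {γ : ℝ → N} {t₀ : ℝ}
    (hγ : ∀ᶠ t in 𝓝 t₀, MDifferentiableAt 𝓘(ℝ, ℝ) 𝓘(ℝ, E) γ t)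
    (h : ∀ᶠ t in 𝓝 t₀, leftLogDeriv E γ t = 0) : ∀ᶠ t in 𝓝 t₀, γ t = γ t₀ := by
  obtain ⟨ε, hε, hb⟩ := Metric.eventually_nhds_iff_ball.1
    ((eventually_differentiableAt_translatedCoord hγ).and
      ((eventually_deriv_translatedCoord hγ).and h))
  have hconst : ∀ t ∈ Metric.ball t₀ ε, translatedCoord E γ t₀ t = translatedCoord E γ t₀ t₀ := by
    intro t ht
    refine Metric.isOpen_ball.is_const_of_deriv_eq_zero (convex_ball t₀ ε).isPreconnected
      (fun x hx => (hb x hx).1.differentiableWithinAt) (fun x hx => ?_) ht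
      (Metric.mem_ball_self hε)
    rw [(hb x hx).2.1, (hb x hx).2.2]
    simp
  filter_upwards [Metric.ball_mem_nhds t₀ hε,
    eventually_eq_mul_translatedCoord (E := E) hγ.self_of_nhds.continuousAt] with t h1 h2
  rw [h2, hconst t h1, translatedCoord_self, extChartAt_to_inv, mul_one]

/-- A curve in a Lie group is determined by its left logarithmic derivative and one value. -/
theorem eqOn_of_leftLogDeriv_eq {γ δ : ℝ → N} {s : Set ℝ} (hs : IsOpen s) (hs' : IsPreconnected s)
    (hγ : ∀ t ∈ s, MDifferentiableAt 𝓘(ℝ, ℝ) 𝓘(ℝ, E) γ t)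
    (hδ : ∀ t ∈ s, MDifferentiableAt 𝓘(ℝ, ℝ) 𝓘(ℝ, E) δ t)
    (h : ∀ t ∈ s, leftLogDeriv E γ t = leftLogDeriv E δ t) {t₀ : ℝ} (ht₀ : t₀ ∈ s)
    (h₀ : γ t₀ = δ t₀) {t : ℝ} (ht : t ∈ s) : γ t = δ t := by
  let η : ℝ → N := fun t => γ t * (δ t)⁻¹
  have hη : ∀ t ∈ s, MDifferentiableAt 𝓘(ℝ, ℝ) 𝓘(ℝ, E) η t := fun t ht =>
    (hγ t ht).lieGroup_mul (hδ t ht).lieGroup_inv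
  have hη0 : ∀ t ∈ s, leftLogDeriv E η t = 0 := by
    intro t ht
    -- By the product rule, the logarithmic derivative of `γ δ⁻¹` involves `γ` only through its
    -- logarithmic derivative. So `γ` may be replaced by `δ`, and `δ δ⁻¹` is constant.
    rw [leftLogDeriv_mul (hγ t ht) (hδ t ht).lieGroup_inv, h t ht,
      ← leftLogDeriv_mul (hδ t ht) (hδ t ht).lieGroup_inv]
    simp only [mul_inv_cancel]
    exact leftLogDeriv_const 1 t
  have : PreconnectedSpace s := Subtype.preconnectedSpace hs'
  have hloc : IsLocallyConstant (fun x : s => η x) := by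
    rw [IsLocallyConstant.iff_eventually_eq]
    intro x
    have hx := hs.mem_nhds x.2
    have h1 := eventually_eq_of_leftLogDeriv_eq_zero (E := E) (γ := η) (t₀ := x)
      (by filter_upwards [hx] with t ht using hη t ht)
      (by filter_upwards [hx] with t ht using hη0 t ht)
    exact continuous_subtype_val.continuousAt.eventually h1
  have h2 := hloc.apply_eq_of_preconnectedSpace ⟨t, ht⟩ ⟨t₀, ht₀⟩
  have h3 : γ t * (δ t)⁻¹ = γ t₀ * (δ t₀)⁻¹ := h2
  rw [h₀, mul_inv_cancel] at h3
  exact mul_inv_eq_one.1 h3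

end Curves

/-! ### The exponential map and the adjoint action -/

section Exponential

open Filter Topology

variable {E : Type*} [NormedAddCommGroup E] [NormedSpace ℝ E] [FiniteDimensional ℝ E]
  {N : Type*} [TopologicalSpace N] [ChartedSpace E N] [Group N] [LieGroup 𝓘(ℝ, E) ∞ N]

theorem mulInvariantVectorField_leftTrivialization (q : N) (v : TangentSpace 𝓘(ℝ, E) q) :
    mulInvariantVectorField (leftTrivialization q v) q = v := by
  have h1 := mfderiv_comp (I := 𝓘(ℝ, E)) (I' := 𝓘(ℝ, E)) (I'' := 𝓘(ℝ, E)) q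
    (mdifferentiableAt_const_mul q (q⁻¹ * q)) (mdifferentiableAt_const_mul q⁻¹ q)
  have h2 : (fun p => q * p) ∘ (fun p => q⁻¹ * p) = (id : N → N) := by ext; simp
  rw [h2, mfderiv_id] at h1
  have h3 := congrArg (fun T : E →L[ℝ] E => T v) h1
  refine Eq.trans ?_ h3.symm
  change (mfderiv 𝓘(ℝ, E) 𝓘(ℝ, E) (fun p : N => q * p) 1 : E →L[ℝ] E)
    ((mfderiv 𝓘(ℝ, E) 𝓘(ℝ, E) (fun p : N => q⁻¹ * p) q : E →L[ℝ] E) v) =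
     (mfderiv 𝓘(ℝ, E) 𝓘(ℝ, E) (fun p : N => q * p) (q⁻¹ * q) : E →L[ℝ] E)
    ((mfderiv 𝓘(ℝ, E) 𝓘(ℝ, E) (fun p : N => q⁻¹ * p) q : E →L[ℝ] E) v)
  rw [inv_mul_cancel]

/-- This turns integral curves of left-invariant fields into curves with constant logarithmic
derivative, to which the uniqueness result for such derivatives applies. -/
theorem hasMFDerivAt_mulInvariantVectorField_iff {γ : ℝ → N} {t : ℝ}
    {X : GroupLieAlgebra 𝓘(ℝ, E) N} :
    HasMFDerivAt 𝓘(ℝ, ℝ) 𝓘(ℝ, E) γ t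
        ((1 : ℝ →L[ℝ] ℝ).smulRight (mulInvariantVectorField X (γ t))) ↔
      MDifferentiableAt 𝓘(ℝ, ℝ) 𝓘(ℝ, E) γ t ∧ leftLogDeriv E γ t 1 = X := by
  constructor
  · intro h
    refine ⟨h.mdifferentiableAt, ?_⟩
    have h1 : mfderiv 𝓘(ℝ, ℝ) 𝓘(ℝ, E) γ t (1 : ℝ) = mulInvariantVectorField X (γ t) := by
      rw [h.mfderiv]
      exact one_smul ℝ _
    refine (leftTrivialization_mfderiv (E := E) γ t 1).symm.trans ?_
    refine Eq.trans ?_ (leftTrivialization_mulInvariantVectorField X (γ t))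
    congr 1
  · rintro ⟨h, h'⟩
    have h1 : mfderiv 𝓘(ℝ, ℝ) 𝓘(ℝ, E) γ t (1 : ℝ) = mulInvariantVectorField X (γ t) := by
      rw [← h']
      exact (mulInvariantVectorField_leftTrivialization (γ t)
        (mfderiv 𝓘(ℝ, ℝ) 𝓘(ℝ, E) γ t (1 : ℝ))).symm
    have h2 : mfderiv 𝓘(ℝ, ℝ) 𝓘(ℝ, E) γ t =
        (1 : ℝ →L[ℝ] ℝ).smulRight (mulInvariantVectorField X (γ t)) := by
      rw [← h1]
      refine ContinuousLinearMap.ext_ring ?_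
      exact (one_smul ℝ _).symm
    rw [← h2]
    exact h.hasMFDerivAt

variable [T2Space N]

/-- Left-invariant fields are complete: left translates of one local integral curve through `1`
exist for the same time `ε` at every starting point, and a uniform existence time suffices. -/
theorem exists_isMIntegralCurve_mulInvariantVectorField (X : GroupLieAlgebra 𝓘(ℝ, E) N) :
    ∃ γ : ℝ → N, γ 0 = 1 ∧
      IsMIntegralCurve (I := 𝓘(ℝ, E)) γ (fun p => mulInvariantVectorField X p) := by
  have : IsManifold 𝓘(ℝ, E) 1 N := IsManifold.of_le (n := ∞) ENat.LEInfty.out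
  have hv : ContMDiff 𝓘(ℝ, E) 𝓘(ℝ, E).tangent 1
      (fun g : N => (⟨g, mulInvariantVectorField X g⟩ : TangentBundle 𝓘(ℝ, E) N)) :=
    (contMDiff_mulInvariantVectorField X).of_le
      (by rw [minSmoothness_of_isRCLikeNormedField]; norm_num)
  obtain ⟨γ, h0, hγ⟩ := exists_isMIntegralCurveAt_of_contMDiffAt_boundaryless (I := 𝓘(ℝ, E))
    (t₀ := 0) (x₀ := (1 : N)) hv.contMDiffAt
  obtain ⟨ε, hε, hγ⟩ := isMIntegralCurveAt_iff'.1 hγ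
  refine exists_isMIntegralCurve_of_isMIntegralCurveOn hv hε (fun x => ⟨fun t => x * γ t, ?_, ?_⟩) 1
  · simp [h0]
  · intro t ht
    have ht' : Metric.ball (0 : ℝ) ε ∈ 𝓝 t := Metric.isOpen_ball.mem_nhds (by
      rw [Real.ball_eq_Ioo]; simpa using ht)
    have h1 := (hγ t (mem_of_mem_nhds ht')).hasMFDerivAt ht'
    obtain ⟨h2, h3⟩ := hasMFDerivAt_mulInvariantVectorField_iff.1 h1
    refine HasMFDerivAt.hasMFDerivWithinAt ?_
    refine hasMFDerivAt_mulInvariantVectorField_iff.2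
      ⟨(mdifferentiableAt_const_mul x (γ t)).comp t h2, ?_⟩
    rw [leftLogDeriv_mul_left x h2, h3]

variable (N) in
/-- The exponential map of `N`, as a map on the model space of the Lie algebra. -/
noncomputable def groupExp (X : E) : N := lieExp (E := E) (N := N) X

theorem leftLogDeriv_ext {γ δ : ℝ → N} {t : ℝ}
    (h : leftLogDeriv E γ t 1 = leftLogDeriv E δ t 1) : leftLogDeriv E γ t = leftLogDeriv E δ t :=
  ContinuousLinearMap.ext_ring h

theorem groupExp_smul_eq {X : E} {γ : ℝ → N} (h0 : γ 0 = 1)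
    (hγ : ∀ t, MDifferentiableAt 𝓘(ℝ, ℝ) 𝓘(ℝ, E) γ t) (hX : ∀ t, leftLogDeriv E γ t 1 = X)
    (a : ℝ) : groupExp N (a • X) = γ a := by
  have hex := exists_isMIntegralCurve_mulInvariantVectorField (N := N) (E := E) (a • X)
  have h1 : groupExp N (a • X) = hex.choose 1 := dif_pos hex
  rw [h1]
  have h2 : ∀ t, MDifferentiableAt 𝓘(ℝ, ℝ) 𝓘(ℝ, E) (γ ∘ fun τ => τ * a) t := fun t =>
    (hγ (t * a)).comp t (by fun_prop : DifferentiableAt ℝ (fun τ => τ * a) t).mdifferentiableAt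
  have h3 : ∀ t, leftLogDeriv E (γ ∘ fun τ => τ * a) t 1 = a • X := by
    intro t
    rw [leftLogDeriv_comp (g := fun τ => τ * a) (hγ (t * a)) (by fun_prop)]
    have h4 : fderiv ℝ (fun τ : ℝ => τ * a) t 1 = a := by
      simp
    rw [ContinuousLinearMap.comp_apply, h4, ← hX (t * a), ← map_smul, smul_eq_mul, mul_one]
  have h5 := fun t => hasMFDerivAt_mulInvariantVectorField_iff.1 (hex.choose_spec.2 t)
  -- Integral curves through `1` are unique, so the choice made in `lieExp` is immaterial.
  have h6 := eqOn_of_leftLogDeriv_eq (γ := hex.choose) (δ := γ ∘ fun τ => τ * a) isOpen_univ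
    isPreconnected_univ (fun t _ => (h5 t).1) (fun t _ => h2 t)
    (fun t _ => leftLogDeriv_ext ((h5 t).2.trans (h3 t).symm)) (Set.mem_univ 0)
    (by rw [hex.choose_spec.1]; simp [h0]) (Set.mem_univ 1)
  rw [h6]
  simp

theorem groupExp_curve (X : E) : (∀ t, MDifferentiableAt 𝓘(ℝ, ℝ) 𝓘(ℝ, E)
    (fun t : ℝ => groupExp N (t • X)) t) ∧
    ∀ t, leftLogDeriv E (fun t : ℝ => groupExp N (t • X)) t 1 = X := by
  obtain ⟨γ, h0, hγ⟩ := exists_isMIntegralCurve_mulInvariantVectorField (N := N) (E := E) X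
  have h5 := fun t => hasMFDerivAt_mulInvariantVectorField_iff.1 (hγ t)
  have h1 : (fun t : ℝ => groupExp N (t • X)) = γ :=
    funext (groupExp_smul_eq h0 (fun t => (h5 t).1) fun t => (h5 t).2)
  rw [h1]
  exact ⟨fun t => (h5 t).1, fun t => (h5 t).2⟩

theorem groupExp_zero : groupExp N (0 : E) = 1 := by
  obtain ⟨γ, h0, hγ⟩ := exists_isMIntegralCurve_mulInvariantVectorField (N := N) (E := E) (0 : E)
  have h5 := fun t => hasMFDerivAt_mulInvariantVectorField_iff.1 (hγ t)
  have := groupExp_smul_eq h0 (fun t => (h5 t).1) (fun t => (h5 t).2) 0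
  rwa [zero_smul, h0] at this

theorem contMDiff_groupExp_smul (X : E) (n : ℕ) :
    ContMDiff 𝓘(ℝ, ℝ) 𝓘(ℝ, E) (n + 1 : ℕ) (fun t : ℝ => groupExp N (t • X)) := by
  intro t
  refine contMDiffAt_succ_of_leftLogDeriv (Eventually.of_forall (groupExp_curve X).1) ?_
  simp only [(groupExp_curve X).2]
  exact contDiffAt_const

theorem adjointInv_one : adjointInv (1 : N) = ContinuousLinearMap.id ℝ E := by
  rw [adjointInv]
  simp only [mul_one]
  exact leftLogDeriv_extChartAt_symm_one

/-- The Maurer–Cartan equation for `(t, s) ↦ exp(tX) exp(sY)` yields `η' = -[Y, η]` for the adjoint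
orbit `η` of `X`. Since `ad Y` squares to zero, `[Y, η]` is constant and the solution is affine in
`s`. -/
theorem adjointInv_groupExp_smul {X Y : E}
    (h : ∀ Z, groupBracket E N Y (groupBracket E N Y Z) = 0) (s : ℝ) :
    adjointInv (groupExp N (s • Y)) X = X - s • groupBracket E N Y X := by
  set η : ℝ → E := fun s => adjointInv (groupExp N (s • Y)) X with hη
  let f : ℝ × ℝ → N := fun p => groupExp N (p.1 • X) * groupExp N (p.2 • Y)
  have hm1 : ∀ p : ℝ × ℝ, MDifferentiableAt 𝓘(ℝ, ℝ × ℝ) 𝓘(ℝ, E)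
      ((fun t : ℝ => groupExp N (t • X)) ∘ Prod.fst) p := fun p =>
    ((groupExp_curve X).1 p.1).comp p differentiableAt_fst.mdifferentiableAt
  have hm2 : ∀ p : ℝ × ℝ, MDifferentiableAt 𝓘(ℝ, ℝ × ℝ) 𝓘(ℝ, E)
      ((fun t : ℝ => groupExp N (t • Y)) ∘ Prod.snd) p := fun p =>
    ((groupExp_curve Y).1 p.2).comp p differentiableAt_snd.mdifferentiableAt
  have hω : ∀ p v, leftLogDeriv E f p v = v.1 • η p.2 + v.2 • Y := by
    intro p v
    have h1 := leftLogDeriv_mul (hm1 p) (hm2 p)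
    rw [leftLogDeriv_comp ((groupExp_curve X).1 p.1) differentiableAt_fst,
      leftLogDeriv_comp ((groupExp_curve Y).1 p.2) differentiableAt_snd] at h1
    have h2 := congrArg (fun T : ℝ × ℝ →L[ℝ] E => T v) h1
    refine h2.trans ?_
    have h3 : ∀ (Z : E) (t a : ℝ), leftLogDeriv E (fun t : ℝ => groupExp N (t • Z)) t a = a • Z := by
      intro Z t a
      conv_rhs => rw [← (groupExp_curve (N := N) Z).2 t, ← map_smul]
      simp
    simp [fderiv_fst, fderiv_snd, h3, hη]
  have hf : ∀ p, ContMDiffAt 𝓘(ℝ, ℝ × ℝ) 𝓘(ℝ, E) 2 f p := by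
    intro p
    have hle : (2 : WithTop ℕ∞) ≤ ∞ := ENat.LEInfty.out
    have := LieGroup.of_le (I := 𝓘(ℝ, E)) (G := N) hle
    refine ContMDiffAt.mul ?_ ?_
    · exact (contMDiff_groupExp_smul X 1).contMDiffAt.comp p
        (contMDiffAt_iff_contDiffAt.2 contDiffAt_fst)
    · exact (contMDiff_groupExp_smul Y 1).contMDiffAt.comp p
        (contMDiffAt_iff_contDiffAt.2 contDiffAt_snd)
  have hωd : ∀ p, DifferentiableAt ℝ (leftLogDeriv E f) p := fun p =>
    (contDiffAt_leftLogDeriv (n := 1) (hf p)).differentiableAt (by simp)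
  have hηd : ∀ s, HasDerivAt η (-groupBracket E N Y (η s)) s := by
    intro s
    have hMC := fderiv_leftLogDeriv_sub (hf (0, s)) (0, 1) (1, 0)
    have h1 : ∀ v : ℝ × ℝ, HasFDerivAt (fun p => leftLogDeriv E f p v)
        ((fderiv ℝ (leftLogDeriv E f) (0, s)).flip v) (0, s) := fun v => by
      simpa using (hωd (0, s)).hasFDerivAt.clm_apply (hasFDerivAt_const v (0, s))
    -- The `s`-component of the logarithmic derivative is the constant `Y`, so its `t`-derivative
    -- drops out.
    have h2 : fderiv ℝ (leftLogDeriv E f) (0, s) (1, 0) (0, 1) = 0 := by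
      have h3 := h1 (0, 1)
      simp only [hω, zero_smul, one_smul, zero_add] at h3
      have := h3.unique (hasFDerivAt_const Y ((0 : ℝ), s))
      exact congrArg (fun T : ℝ × ℝ →L[ℝ] E => T (1, 0)) this
    have h4 : HasDerivAt η (fderiv ℝ (leftLogDeriv E f) (0, s) (0, 1) (1, 0)) s := by
      have h5 := h1 (1, 0)
      have h6 : HasDerivAt (fun s : ℝ => ((0 : ℝ), s)) (0, 1) s :=
        (hasDerivAt_const s (0 : ℝ)).prodMk (hasDerivAt_id s)
      have h7 := h5.comp_hasDerivAt s h6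
      simpa [Function.comp_def, hω] using h7
    rw [h2, sub_zero, hω, hω] at hMC
    simpa [hMC] using h4
  have h1 : ∀ s, groupBracket E N Y (η s) = groupBracket E N Y (η 0) := by
    intro s
    refine is_const_of_deriv_eq_zero (f := fun s => groupBracket E N Y (η s))
      (fun s => ((groupBracket E N Y).hasFDerivAt.comp_hasDerivAt s (hηd s)).differentiableAt)
      (fun s => ?_) s 0
    exact ((groupBracket E N Y).hasFDerivAt.comp_hasDerivAt s (hηd s)).deriv.trans (by simp [h])
  have h2 : ∀ s, HasDerivAt (fun s => η s + s • groupBracket E N Y (η 0)) 0 s := by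
    intro s
    exact ((hηd s).add ((hasDerivAt_id s).smul_const (groupBracket E N Y (η 0)))).congr_deriv
      (by rw [h1]; simp)
  have h3 := is_const_of_deriv_eq_zero (fun s => (h2 s).differentiableAt) (fun s => (h2 s).deriv) s 0
  have h0 : η 0 = X := by simp [hη, groupExp_zero, adjointInv_one]
  simp only [h0, zero_smul, add_zero] at h3
  exact eq_sub_of_add_eq h3

end Exponential

/-! ### Baker–Campbell–Hausdorff in the 2-step case -/

section TwoStep

open Filter Topology

variable {E : Type*} [NormedAddCommGroup E] [NormedSpace ℝ E] [FiniteDimensional ℝ E]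
  {N : Type*} [TopologicalSpace N] [ChartedSpace E N] [Group N] [LieGroup 𝓘(ℝ, E) ∞ N]
  [T2Space N]

/-- The Baker–Campbell–Hausdorff formula for a 2-step nilpotent Lie group. -/
theorem groupExp_mul_groupExp_mul
    (h : ∀ X Y Z : E, groupBracket E N X (groupBracket E N Y Z) = 0) (X Y : E) :
    groupExp N X * groupExp N Y * groupExp N (-(1 / 2 : ℝ) • groupBracket E N X Y) =
      groupExp N (X + Y) := by
  set Z := groupBracket E N X Y with hZ
  -- The logarithmic derivative of `exp(sX) exp(sY)` is `X + Y + s[X, Y]`. The central factor with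
  -- exponent `-½s²[X, Y]` removes the last term, leaving the one-parameter group of `X + Y`.
  let f : ℝ → N := fun s => groupExp N (s • X) * groupExp N (s • Y) *
    ((fun t : ℝ => groupExp N (t • Z)) ∘ fun s => -(1 / 2 : ℝ) * s ^ 2) s
  have hq : ∀ s, HasDerivAt (fun s : ℝ => -(1 / 2 : ℝ) * s ^ 2) (-s) s := fun s =>
    ((hasDerivAt_pow 2 s).const_mul (-(1 / 2 : ℝ))).congr_deriv (by simp)
  have hm1 : ∀ s, MDifferentiableAt 𝓘(ℝ, ℝ) 𝓘(ℝ, E)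
      (fun s : ℝ => groupExp N (s • X) * groupExp N (s • Y)) s := fun s =>
    ((groupExp_curve X).1 s).lieGroup_mul ((groupExp_curve Y).1 s)
  have hm2 : ∀ s, MDifferentiableAt 𝓘(ℝ, ℝ) 𝓘(ℝ, E)
      ((fun t : ℝ => groupExp N (t • Z)) ∘ fun s => -(1 / 2 : ℝ) * s ^ 2) s := fun s =>
    ((groupExp_curve Z).1 _).comp s (hq s).differentiableAt.mdifferentiableAt
  have hf : ∀ s, leftLogDeriv E f s 1 = X + Y := by
    intro s
    have h1 := leftLogDeriv_mul (hm1 s) (hm2 s)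
    rw [leftLogDeriv_mul ((groupExp_curve X).1 s) ((groupExp_curve Y).1 s),
      leftLogDeriv_comp ((groupExp_curve Z).1 _) (hq s).differentiableAt] at h1
    refine (congrArg (fun T : ℝ →L[ℝ] E => T 1) h1).trans ?_
    have hZ0 : ∀ W, groupBracket E N Z W = 0 := fun W => by
      rw [groupBracket_skew, hZ, h, neg_zero]
    have h3 : ∀ t a : ℝ, leftLogDeriv E (fun t : ℝ => groupExp N (t • Z)) t a = a • Z := by
      intro t a
      conv_rhs => rw [← (groupExp_curve (N := N) Z).2 t, ← map_smul]
      simp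
    simp only [Function.comp_apply, ContinuousLinearMap.comp_apply, _root_.add_apply,
      (groupExp_curve X).2, (groupExp_curve Y).2, h3]
    rw [adjointInv_groupExp_smul (fun W => hZ0 _), adjointInv_groupExp_smul (fun W => h Y Y W),
      hZ0, groupBracket_skew (N := N) Y X, ← hZ]
    have h4 : fderiv ℝ (fun s : ℝ => -(1 / 2 : ℝ) * s ^ 2) s 1 = -s := by
      rw [(hq s).hasFDerivAt.fderiv]
      simp
    rw [h4]
    module
  have h1 := groupExp_smul_eq (by simp [groupExp_zero])
    (fun s => (hm1 s).lieGroup_mul (hm2 s)) hf 1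
  simpa [f] using h1.symm

theorem groupExp_mul_of_groupBracket_eq_zero
    (h : ∀ X Y Z : E, groupBracket E N X (groupBracket E N Y Z) = 0) {X Y : E}
    (hXY : groupBracket E N X Y = 0) : groupExp N X * groupExp N Y = groupExp N (X + Y) := by
  have := groupExp_mul_groupExp_mul h X Y
  rwa [hXY, smul_zero, groupExp_zero, mul_one] at this

theorem groupExp_mul
    (h : ∀ X Y Z : E, groupBracket E N X (groupBracket E N Y Z) = 0) (X Y : E) :
    groupExp N X * groupExp N Y = groupExp N (X + Y + (1 / 2 : ℝ) • groupBracket E N X Y) := by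
  have h1 := groupExp_mul_of_groupBracket_eq_zero h
    (X := -(1 / 2 : ℝ) • groupBracket E N X Y) (Y := (1 / 2 : ℝ) • groupBracket E N X Y)
    (by simp [h])
  have h2 := groupExp_mul_of_groupBracket_eq_zero h
    (X := X + Y) (Y := (1 / 2 : ℝ) • groupBracket E N X Y) (by simp [h])
  rw [← h2, ← groupExp_mul_groupExp_mul h X Y, mul_assoc _ _ (groupExp N _), h1]
  rw [neg_smul, neg_add_cancel, groupExp_zero, mul_one]

/-- Only the one-parameter groups are known to be differentiable so far, so differentiability at `0`
is obtained by adding one basis coordinate at a time. -/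
theorem groupExp_leftLogDeriv_zero
    (h : ∀ X Y Z : E, groupBracket E N X (groupBracket E N Y Z) = 0) :
    MDifferentiableAt 𝓘(ℝ, E) 𝓘(ℝ, E) (groupExp N : E → N) 0 ∧
      leftLogDeriv E (groupExp N : E → N) 0 = ContinuousLinearMap.id ℝ E := by
  classical
  let b := Module.finBasis ℝ E
  let β : Fin (Module.finrank ℝ E) → E →L[ℝ] ℝ := fun i => LinearMap.toContinuousLinearMap (b.coord i)
  let P : Finset (Fin (Module.finrank ℝ E)) → E →L[ℝ] E := fun S =>
    ∑ i ∈ S, (β i).smulRight (b i)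
  -- Splitting off a coordinate by Baker–Campbell–Hausdorff leaves a correction of the same form
  -- with another linear map `T'`, evaluated at the quadratic argument `β j x • x`. The induction is
  -- therefore over all `T`; the correction has zero derivative at `0`.
  have key : ∀ S, ∀ T : E →L[ℝ] E,
      MDifferentiableAt 𝓘(ℝ, E) 𝓘(ℝ, E) (fun x => groupExp N (T (P S x))) 0 ∧
        leftLogDeriv E (fun x => groupExp N (T (P S x))) 0 = T.comp (P S) := by
    intro S
    induction S using Finset.induction_on with
    | empty =>
      intro T
      simp only [P, Finset.sum_empty, _root_.zero_apply, map_zero,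
        ContinuousLinearMap.comp_zero]
      refine ⟨mdifferentiableAt_const, ?_⟩
      rw [leftLogDeriv_eq_fderiv mdifferentiableAt_const]
      simp
    | insert j S hj ih =>
      intro T
      let T' : E →L[ℝ] E := -(1 / 2 : ℝ) • ((groupBracket E N).flip (T (b j))).comp T
      have hPj : ∀ x, P (insert j S) x = β j x • b j + P S x := by
        intro x
        simp [P, Finset.sum_insert hj]
      have hfac : (fun x => groupExp N (T (P (insert j S) x))) = fun x =>
          (groupExp N (T (P S x)) * ((fun t : ℝ => groupExp N (t • T (b j))) ∘ β j) x) *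
            ((fun x => groupExp N (T' (P S x))) ∘ fun x => β j x • x) x := by
        funext x
        have := groupExp_mul_groupExp_mul h (T (P S x)) (β j x • T (b j))
        rw [hPj, map_add, map_smul, add_comm, ← this]
        simp [T', smul_smul]
      have hd : HasFDerivAt (fun x => β j x • x) (0 : E →L[ℝ] E) 0 := by
        exact ((β j).hasFDerivAt.smul (hasFDerivAt_id (0 : E))).congr_fderiv (by simp)
      obtain ⟨i1, i2⟩ := ih T
      obtain ⟨i3, i4⟩ := ih T'
      have z3 : (fun x => β j x • x) (0 : E) = 0 := by simp
      have i3' : MDifferentiableAt 𝓘(ℝ, E) 𝓘(ℝ, E) (fun x => groupExp N (T' (P S x)))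
          ((fun x => β j x • x) (0 : E)) := by rwa [z3]
      have m2 := ((groupExp_curve (N := N) (T (b j))).1 (β j 0)).comp (0 : E)
        (β j).differentiableAt.mdifferentiableAt
      have m3 := MDifferentiableAt.comp (f := fun x => β j x • x) (0 : E) i3' hd.differentiableAt.mdifferentiableAt
      rw [hfac]
      refine ⟨(i1.lieGroup_mul m2).lieGroup_mul m3, ?_⟩
      rw [leftLogDeriv_mul (i1.lieGroup_mul m2) m3, leftLogDeriv_mul i1 m2,
        leftLogDeriv_comp ((groupExp_curve (N := N) (T (b j))).1 (β j 0)) (β j).differentiableAt,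
        leftLogDeriv_comp (g := fun x => β j x • x) i3' hd.differentiableAt, hd.fderiv, i2]
      simp only [Function.comp_apply, map_zero, zero_smul, groupExp_zero, adjointInv_one]
      ext x
      have h3 : ∀ t a : ℝ, leftLogDeriv E (fun t : ℝ => groupExp N (t • T (b j))) t a =
          a • T (b j) := by
        intro t a
        conv_rhs => rw [← (groupExp_curve (N := N) (T (b j))).2 t, ← map_smul]
        simp
      simp [h3, hPj, add_comm]
  have h1 : P Finset.univ = ContinuousLinearMap.id ℝ E := by
    ext x
    simp [P, β, b.sum_repr x]
  have h2 := key Finset.univ (ContinuousLinearMap.id ℝ E)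
  simpa [h1] using h2

/-- Factoring `exp(y τ) = exp(y t) exp(η τ)` with `η t = 0` reduces the derivative of the
exponential map at `y t` to its derivative at `0`. -/
theorem leftLogDeriv_groupExp_comp
    (h : ∀ X Y Z : E, groupBracket E N X (groupBracket E N Y Z) = 0) {y : ℝ → E} {y' : E} {t : ℝ}
    (hy : HasDerivAt y y' t) :
    MDifferentiableAt 𝓘(ℝ, ℝ) 𝓘(ℝ, E) (fun τ => groupExp N (y τ)) t ∧
      leftLogDeriv E (fun τ => groupExp N (y τ)) t 1 =
        y' - (1 / 2 : ℝ) • groupBracket E N (y t) y' := by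
  let η : ℝ → E := fun τ => (y τ - y t) - (1 / 2 : ℝ) • groupBracket E N (y t) (y τ)
  have hη : HasDerivAt η (y' - (1 / 2 : ℝ) • groupBracket E N (y t) y') t :=
    (hy.sub_const (y t)).sub
      (((groupBracket E N (y t)).hasFDerivAt.comp_hasDerivAt t hy).const_smul (1 / 2 : ℝ))
  have hη0 : η t = 0 := by simp [η, groupBracket_self]
  have hfac : (fun τ => groupExp N (y τ)) = fun τ => groupExp N (y t) * (groupExp N ∘ η) τ := by
    funext τ
    rw [Function.comp_apply, groupExp_mul h]
    congr 1
    simp only [η, map_sub, map_smul, h, groupBracket_self]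
    module
  obtain ⟨h1, h2⟩ := groupExp_leftLogDeriv_zero (N := N) h
  rw [← hη0] at h1 h2
  have h3 := h1.comp t hη.differentiableAt.mdifferentiableAt
  rw [hfac]
  refine ⟨(mdifferentiableAt_const_mul _ _).comp t h3, ?_⟩
  rw [leftLogDeriv_mul_left _ h3, leftLogDeriv_comp h1 hη.differentiableAt, h2]
  simp [hη.hasFDerivAt.fderiv]

end TwoStep

/-! ### The Euler–Arnold equation -/

section GeodesicEquation

open Filter Topology

variable {E : Type*} [NormedAddCommGroup E] [NormedSpace ℝ E] [FiniteDimensional ℝ E]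
  {N : Type*} [TopologicalSpace N] [ChartedSpace E N] [Group N] [LieGroup 𝓘(ℝ, E) ∞ N]

/-- A bilinear form on the Lie algebra, as a continuous bilinear form on the model space. -/
noncomputable def groupForm (B : BilinForm ℝ (GroupLieAlgebra 𝓘(ℝ, E) N)) : E →L[ℝ] E →L[ℝ] ℝ :=
  LinearMap.toContinuousBilinearMap (E := E) (F := E) (G := ℝ) B

/-- Needed to pass from coordinate test vectors in the geodesic equation to arbitrary test vectors
in the Lie algebra. -/
theorem surjective_leftLogDeriv_extChartAt_symm (p : N) :
    Function.Surjective
      (leftLogDeriv E (extChartAt 𝓘(ℝ, E) p).symm (extChartAt 𝓘(ℝ, E) p p)) := by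
  have : IsManifold 𝓘(ℝ, E) 1 N := IsManifold.of_le (n := ∞) ENat.LEInfty.out
  intro X
  have h1 := isInvertible_mfderivWithin_extChartAt_symm (I := 𝓘(ℝ, E)) (mem_extChartAt_target p)
  simp only [modelWithCornersSelf_coe, Set.range_id, mfderivWithin_univ] at h1
  obtain ⟨v, hv⟩ := h1.surjective (mulInvariantVectorField X _)
  refine ⟨v, ?_⟩
  refine (leftTrivialization_mfderiv (E := E) (extChartAt 𝓘(ℝ, E) p).symm _ v).symm.trans ?_
  refine Eq.trans ?_ (leftTrivialization_mulInvariantVectorField X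
    ((extChartAt 𝓘(ℝ, E) p).symm (extChartAt 𝓘(ℝ, E) p p)))
  exact congrArg _ hv

theorem chartMetric_leftInvariantMetric (B : BilinForm ℝ (GroupLieAlgebra 𝓘(ℝ, E) N)) (p : N)
    (x v w : E) : chartMetric (leftInvariantMetric B) p x v w =
      groupForm B (leftLogDeriv E (extChartAt 𝓘(ℝ, E) p).symm x v)
        (leftLogDeriv E (extChartAt 𝓘(ℝ, E) p).symm x w) := rfl

/-- The geodesic equation of a left-invariant metric is the Euler–Arnold equation for the left
logarithmic derivative. -/
theorem geodesicEquationAt_leftInvariantMetric_iff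
    {B : BilinForm ℝ (GroupLieAlgebra 𝓘(ℝ, E) N)} (hB : B.IsSymm) {γ : ℝ → N} {t : ℝ}
    (hγ : ContMDiffAt 𝓘(ℝ, ℝ) 𝓘(ℝ, E) 2 γ t) :
    GeodesicEquationAt (leftInvariantMetric B) (γ t) (fun τ => extChartAt 𝓘(ℝ, E) (γ t) (γ τ)) t ↔
      ∀ w : E, groupForm B (deriv (fun τ => leftLogDeriv E γ τ 1) t) w =
        groupForm B (leftLogDeriv E γ t 1) (groupBracket E N (leftLogDeriv E γ t 1) w) := by
  have hle : (2 : WithTop ℕ∞) ≤ ∞ := ENat.LEInfty.out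
  have hm2 : IsManifold 𝓘(ℝ, E) 2 N := IsManifold.of_le (n := ∞) hle
  set p := γ t with hp
  set φ := extChartAt 𝓘(ℝ, E) p with hφ
  set c : ℝ → E := fun τ => φ (γ τ) with hc
  set A := leftLogDeriv E φ.symm with hA
  set b := groupForm B with hb
  have hbs : ∀ v w, b v w = b w v := fun v w => hB.eq v w
  have hct : c t = φ p := rfl
  have hcd : ContDiffAt ℝ 2 c t := by
    rw [← contMDiffAt_iff_contDiffAt]
    exact ContMDiffAt.comp t (contMDiffAt_extChartAt (I := 𝓘(ℝ, E)) (n := 2) (x := p)) hγ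
  have hsymm : ContMDiffAt 𝓘(ℝ, E) 𝓘(ℝ, E) 2 φ.symm (c t) :=
    contMDiffAt_extChartAt_symm hle (mem_extChartAt_target p)
  have hAd : DifferentiableAt ℝ A (c t) :=
    (contDiffAt_leftLogDeriv (n := 1) hsymm).differentiableAt (by simp)
  have hξ : (fun τ => leftLogDeriv E γ τ 1) =ᶠ[𝓝 t] fun τ => A (c τ) (deriv c τ) := by
    have h1 : γ =ᶠ[𝓝 t] φ.symm ∘ c := by
      filter_upwards [hγ.continuousAt.preimage_mem_nhds
        (extChartAt_source_mem_nhds (I := 𝓘(ℝ, E)) p)] with τ hτ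
      exact (φ.left_inv hτ).symm
    have h2 : ∀ᶠ τ in 𝓝 t, c τ ∈ φ.target := hcd.continuousAt.preimage_mem_nhds
      (extChartAt_target_mem_nhds (I := 𝓘(ℝ, E)) p)
    filter_upwards [h1.eventuallyEq_nhds, h2, hcd.eventually (by simp)] with τ h3 h4 h5
    rw [h3.leftLogDeriv_eq, leftLogDeriv_comp (mdifferentiableAt_extChartAt_symm' h4)
      (h5.differentiableAt (by simp))]
    rw [ContinuousLinearMap.comp_apply, fderiv_apply_one_eq_deriv]
  have hc1 : HasDerivAt c (deriv c t) t := (hcd.differentiableAt (by simp)).hasDerivAt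
  have hc2 : HasDerivAt (deriv c) (deriv (deriv c) t) t := by
    have h1 : ContDiffAt ℝ 1 (fderiv ℝ c) t := hcd.fderiv_right (by norm_num)
    have h2 : DifferentiableAt ℝ (fun τ => fderiv ℝ c τ 1) t :=
      (h1.differentiableAt (by simp)).clm_apply (differentiableAt_const _)
    exact DifferentiableAt.hasDerivAt h2
  have hξt : leftLogDeriv E γ t 1 = A (c t) (deriv c t) := hξ.self_of_nhds
  have hξ' : deriv (fun τ => leftLogDeriv E γ τ 1) t =
      fderiv ℝ A (c t) (deriv c t) (deriv c t) + A (c t) (deriv (deriv c) t) := by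
    rw [hξ.deriv_eq]
    exact ((hAd.hasFDerivAt.comp_hasDerivAt t hc1).clm_apply hc2).deriv
  have hAv : ∀ v, HasFDerivAt (fun x => A x v) ((fderiv ℝ A (c t)).flip v) (c t) := fun v => by
    simpa using hAd.hasFDerivAt.clm_apply (hasFDerivAt_const v (c t))
  have hg : ∀ v w u, fderiv ℝ (fun x => chartMetric (leftInvariantMetric B) p x v w) (c t) u =
      b (fderiv ℝ A (c t) u v) (A (c t) w) + b (A (c t) v) (fderiv ℝ A (c t) u w) := by
    intro v w u
    have h1 : HasFDerivAt (fun x => b (A x v) (A x w)) _ (c t) :=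
      (b.hasFDerivAt.comp (c t) (hAv v)).clm_apply (hAv w)
    change fderiv ℝ (fun x => b (A x v) (A x w)) (c t) u = _
    rw [h1.fderiv]
    simp [add_comm]
  -- Interchanging the two arguments of `DA` costs a bracket. This is the only source of the term
  -- `⟨ξ, [ξ, w]⟩`; the other first-order terms cancel or combine into `ξ̇`.
  have hMC : ∀ w, fderiv ℝ A (c t) w (deriv c t) = fderiv ℝ A (c t) (deriv c t) w +
      groupBracket E N (A (c t) (deriv c t)) (A (c t) w) := by
    intro w
    have := fderiv_leftLogDeriv_sub hsymm w (deriv c t)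
    rw [groupBracket_skew, neg_neg] at this
    exact (sub_eq_iff_eq_add'.1 this)
  have key : ∀ w, chartMetric (leftInvariantMetric B) p (c t) (deriv (deriv c) t) w
      + fderiv ℝ (fun x => chartMetric (leftInvariantMetric B) p x (deriv c t) w) (c t) (deriv c t)
      - (1 / 2 : ℝ) * fderiv ℝ (fun x =>
        chartMetric (leftInvariantMetric B) p x (deriv c t) (deriv c t)) (c t) w =
      b (deriv (fun τ => leftLogDeriv E γ τ 1) t) (A (c t) w) - b (leftLogDeriv E γ t 1)
        (groupBracket E N (leftLogDeriv E γ t 1) (A (c t) w)) := by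
    intro w
    rw [hg, hg, hξ', hξt, chartMetric_leftInvariantMetric, hMC w]
    change b (A (c t) (deriv (deriv c) t)) (A (c t) w) + _ - _ = _
    simp only [map_add, _root_.add_apply]
    rw [hbs (fderiv ℝ A (c t) (deriv c t) w), hbs (groupBracket E N _ _)]
    ring
  constructor
  · intro h w
    obtain ⟨v, rfl⟩ := surjective_leftLogDeriv_extChartAt_symm p w
    have := h v
    rw [key v] at this
    exact sub_eq_zero.1 this
  · intro h w
    rw [key w]
    exact sub_eq_zero.2 (h _)

end GeodesicEquation

/-! ### Linearization and uniqueness of geodesics -/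

section Geodesics

open Filter Topology

variable {E : Type*} [NormedAddCommGroup E] [NormedSpace ℝ E] [FiniteDimensional ℝ E]
  {N : Type*} [TopologicalSpace N] [ChartedSpace E N] [Group N] [LieGroup 𝓘(ℝ, E) ∞ N]
  {B : BilinForm ℝ (GroupLieAlgebra 𝓘(ℝ, E) N)}

theorem isGeodesicOn_leftInvariantMetric (hB : B.IsSymm) {γ : ℝ → N} {s : Set ℝ} (hs : IsOpen s)
    {ξ ξ' : ℝ → E} (hγ : ∀ t ∈ s, MDifferentiableAt 𝓘(ℝ, ℝ) 𝓘(ℝ, E) γ t)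
    (hγξ : ∀ t ∈ s, leftLogDeriv E γ t 1 = ξ t) (hξ1 : ContDiffOn ℝ 1 ξ s)
    (hξ : ∀ t ∈ s, HasDerivAt ξ (ξ' t) t)
    (h : ∀ t ∈ s, ∀ w : E, groupForm B (ξ' t) w = groupForm B (ξ t) (groupBracket E N (ξ t) w)) :
    IsGeodesicOn (leftInvariantMetric B) γ s := by
  have hev : ∀ t ∈ s, (fun τ => leftLogDeriv E γ τ 1) =ᶠ[𝓝 t] ξ := fun t ht => by
    filter_upwards [hs.mem_nhds ht] with τ hτ using hγξ τ hτ
  have hC2 : ∀ t ∈ s, ContMDiffAt 𝓘(ℝ, ℝ) 𝓘(ℝ, E) 2 γ t := by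
    intro t ht
    refine contMDiffAt_succ_of_leftLogDeriv (n := 1) ?_ ?_
    · filter_upwards [hs.mem_nhds ht] with τ hτ using hγ τ hτ
    · exact (hξ1.contDiffAt (hs.mem_nhds ht)).congr_of_eventuallyEq (hev t ht)
  refine ⟨fun t ht => (hC2 t ht).contMDiffWithinAt, fun t ht => ?_⟩
  rw [geodesicEquationAt_leftInvariantMetric_iff hB (hC2 t ht)]
  intro w
  rw [(hev t ht).deriv_eq, (hξ t ht).deriv, hγξ t ht]
  exact h t ht w

theorem IsGeodesicOn.hasDerivAt_leftLogDeriv (hB : B.IsSymm) {γ : ℝ → N} {s : Set ℝ}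
    (hs : IsOpen s) (hγ : IsGeodesicOn (leftInvariantMetric B) γ s) :
    (∀ t ∈ s, MDifferentiableAt 𝓘(ℝ, ℝ) 𝓘(ℝ, E) γ t) ∧ ∀ t ∈ s,
      ∃ ξ' : E, HasDerivAt (fun τ => leftLogDeriv E γ τ 1) ξ' t ∧
        ∀ w : E, groupForm B ξ' w =
          groupForm B (leftLogDeriv E γ t 1) (groupBracket E N (leftLogDeriv E γ t 1) w) := by
  have hC2 : ∀ t ∈ s, ContMDiffAt 𝓘(ℝ, ℝ) 𝓘(ℝ, E) 2 γ t := fun t ht =>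
    hγ.contMDiffOn.contMDiffAt (hs.mem_nhds ht)
  refine ⟨fun t ht => (hC2 t ht).mdifferentiableAt (by simp), fun t ht => ⟨_, ?_,
    (geodesicEquationAt_leftInvariantMetric_iff hB (hC2 t ht)).1 (hγ.equation t ht)⟩⟩
  have h1 := (contDiffAt_leftLogDeriv (n := 1) (hC2 t ht)).differentiableAt (by simp)
  exact (h1.clm_apply (differentiableAt_const (1 : ℝ))).hasDerivAt

/-- The product `e^{-tT}(f - g)` has zero derivative, and `e^{-tT}` is invertible. -/
theorem eqOn_of_hasDerivAt_linear {T : E →L[ℝ] E} {f g : ℝ → E} {s : Set ℝ} (hs : IsOpen s)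
    (hs' : IsPreconnected s) (hf : ∀ t ∈ s, HasDerivAt f (T (f t)) t)
    (hg : ∀ t ∈ s, HasDerivAt g (T (g t)) t) {t₀ : ℝ} (ht₀ : t₀ ∈ s) (h₀ : f t₀ = g t₀) {t : ℝ}
    (ht : t ∈ s) : f t = g t := by
  let u : ℝ → E →L[ℝ] E := fun t => NormedSpace.exp (t • -T)
  have hu : ∀ t, HasDerivAt u (u t * -T) t := fun t => hasDerivAt_exp_smul_const (-T) t
  have hd : ∀ t ∈ s, HasDerivAt (fun t => u t (f t - g t)) 0 t := by
    intro t ht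
    exact ((hu t).clm_apply ((hf t ht).sub (hg t ht))).congr_deriv (by simp)
  have h1 := hs.is_const_of_deriv_eq_zero hs'
    (fun t ht => (hd t ht).differentiableAt.differentiableWithinAt)
    (fun t ht => (hd t ht).deriv) ht ht₀
  have h2 : u t (f t - g t) = 0 := by simpa [h₀] using h1
  let _ := NormedAlgebra.restrictScalars ℚ ℝ (E →L[ℝ] E)
  obtain ⟨v, hv⟩ := (NormedSpace.isUnit_exp (t • -T)).exists_left_inv
  have h3 : (v * u t) (f t - g t) = 0 := by
    rw [mul_apply_eq_comp, h2, map_zero]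
  rw [show v * u t = 1 from hv] at h3
  exact sub_eq_zero.1 h3

theorem groupForm_injective (hB : B.Nondegenerate) {x y : E}
    (h : ∀ w, groupForm B x w = groupForm B y w) : x = y :=
  (B.toDual hB).injective (LinearMap.ext h)

/-- The operator `x ↦ ad†_x c`, as a continuous linear map on the model space. -/
noncomputable def adDaggerCLM (hB : B.Nondegenerate) (c : E) : E →L[ℝ] E :=
  LinearMap.toContinuousLinearMap (E := E) (F' := E) (adDagger B hB c)

theorem groupForm_adDaggerCLM (hB : B.Nondegenerate) (c x w : E) :
    groupForm B (adDaggerCLM hB c x) w = groupForm B c (groupBracket E N x w) :=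
  adDagger_spec B hB c x w

/-- For a 2-step nilpotent Lie algebra the Euler–Arnold equation is linear along its solutions. -/
theorem hasDerivAt_of_eulerArnold (hB : B.Nondegenerate)
    (h2 : ∀ X Y Z : E, groupBracket E N X (groupBracket E N Y Z) = 0) {ξ : ℝ → E} {s : Set ℝ}
    (hs : IsOpen s) (hs' : IsPreconnected s)
    (hξ : ∀ t ∈ s, ∃ ξ' : E, HasDerivAt ξ ξ' t ∧
      ∀ w : E, groupForm B ξ' w = groupForm B (ξ t) (groupBracket E N (ξ t) w)) {t₀ : ℝ}
    (ht₀ : t₀ ∈ s) : ∀ t ∈ s, HasDerivAt ξ (adDaggerCLM hB (ξ t₀) (ξ t)) t := by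
  -- Conservation law: testing the equation with `w = [X, Y]` produces a double bracket, which
  -- vanishes. So `ξ t` may be replaced by `ξ t₀` in its pairing with the bracket.
  have hcons : ∀ X Y, ∀ t ∈ s, groupForm B (ξ t) (groupBracket E N X Y) =
      groupForm B (ξ t₀) (groupBracket E N X Y) := by
    intro X Y t ht
    have hd : ∀ t ∈ s, HasDerivAt (fun t => groupForm B (ξ t) (groupBracket E N X Y)) 0 t := by
      intro t ht
      obtain ⟨ξ', h3, h4⟩ := hξ t ht
      refine (((groupForm B).hasFDerivAt.comp_hasDerivAt t h3).clm_apply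
        (hasDerivAt_const t (groupBracket E N X Y))).congr_deriv ?_
      simp [h4, h2]
    exact hs.is_const_of_deriv_eq_zero hs'
      (fun t ht => (hd t ht).differentiableAt.differentiableWithinAt)
      (fun t ht => (hd t ht).deriv) ht ht₀
  intro t ht
  obtain ⟨ξ', h3, h4⟩ := hξ t ht
  have : ξ' = adDaggerCLM hB (ξ t₀) (ξ t) := groupForm_injective hB fun w => by
    rw [h4, groupForm_adDaggerCLM, hcons _ _ t ht]
  rwa [← this]

/-- Geodesics of a left-invariant metric on a 2-step nilpotent Lie group are determined by their
initial velocity. -/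
theorem IsGeodesicOn.eqOn (hBs : B.IsSymm) (hB : B.Nondegenerate)
    (h2 : ∀ X Y Z : E, groupBracket E N X (groupBracket E N Y Z) = 0) {γ δ : ℝ → N} {s : Set ℝ}
    (hs : IsOpen s) (hs' : IsPreconnected s) (hγ : IsGeodesicOn (leftInvariantMetric B) γ s)
    (hδ : IsGeodesicOn (leftInvariantMetric B) δ s) {t₀ : ℝ} (ht₀ : t₀ ∈ s) (h₀ : γ t₀ = δ t₀)
    (h₁ : leftLogDeriv E γ t₀ 1 = leftLogDeriv E δ t₀ 1) : ∀ t ∈ s, γ t = δ t := by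
  intro t ht
  obtain ⟨hγ1, hγ2⟩ := hγ.hasDerivAt_leftLogDeriv hBs hs
  obtain ⟨hδ1, hδ2⟩ := hδ.hasDerivAt_leftLogDeriv hBs hs
  refine eqOn_of_leftLogDeriv_eq hs hs' hγ1 hδ1 (fun t ht => ContinuousLinearMap.ext_ring ?_)
    ht₀ h₀ ht
  have h3 := hasDerivAt_of_eulerArnold hB h2 hs hs' hγ2 ht₀
  have h4 := hasDerivAt_of_eulerArnold hB h2 hs hs' hδ2 ht₀
  rw [← h₁] at h4
  exact eqOn_of_hasDerivAt_linear hs hs' h3 h4 ht₀ h₁ ht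

theorem velocity_eq_iff {γ : ℝ → N} {t : ℝ} {p : N} {v : TangentSpace 𝓘(ℝ, E) p} :
    velocity γ t = (⟨p, v⟩ : TangentBundle 𝓘(ℝ, E) N) ↔
      γ t = p ∧ leftLogDeriv E γ t 1 = leftTrivialization p v := by
  constructor
  · intro h
    refine ⟨congrArg (fun η : TangentBundle 𝓘(ℝ, E) N => η.proj) h, ?_⟩
    exact congrArg (fun η : TangentBundle 𝓘(ℝ, E) N =>
      (leftTrivialization η.proj η.2 : GroupLieAlgebra 𝓘(ℝ, E) N)) h
  · rintro ⟨rfl, h⟩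
    have h1 : leftTrivialization (γ t) (mfderiv 𝓘(ℝ, ℝ) 𝓘(ℝ, E) γ t (1 : ℝ)) =
      leftTrivialization (γ t) v := h
    have h3 : mfderiv 𝓘(ℝ, ℝ) 𝓘(ℝ, E) γ t (1 : ℝ) = v := by
      rw [← mulInvariantVectorField_leftTrivialization (γ t) v, ← h1,
        mulInvariantVectorField_leftTrivialization]
    rw [velocity, h3]

theorem leftTrivialization_one (v : GroupLieAlgebra 𝓘(ℝ, E) N) :
    leftTrivialization (1 : N) v = v := by
  have h1 : (fun q : N => (1 : N)⁻¹ * q) = id := by ext; simp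
  have h2 := mfderiv_id (I := 𝓘(ℝ, E)) (x := (1 : N))
  rw [← h1] at h2
  exact congrArg (fun T : E →L[ℝ] E => T v) h2

end Geodesics

/-! ### Orthogonality in the null splitting and the operator `J` -/

namespace NullSplitting

variable {L : Type*} [LieRing L] [LieAlgebra ℝ L] {B : BilinForm ℝ L} (D : NullSplitting B)

theorem proj_mem (i : Fin 4) (x : L) : D.proj i x ∈ ![D.U, D.Z, D.V, D.E] i := by
  simp only [proj, LinearMap.comp_apply]
  exact Subtype.coe_prop _

theorem projU_mem (x : L) : D.projU x ∈ D.U := D.proj_mem 0 x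

theorem projZ_mem (x : L) : D.projZ x ∈ D.Z := D.proj_mem 1 x

theorem projE_mem (x : L) : D.projE x ∈ D.E := D.proj_mem 3 x

/-- The `𝔙`-component. -/
noncomputable def projV : L →ₗ[ℝ] L := D.proj 2

theorem projV_mem (x : L) : D.projV x ∈ D.V := D.proj_mem 2 x

theorem proj_of_mem {i j : Fin 4} {x : L} (hx : x ∈ ![D.U, D.Z, D.V, D.E] j) :
    D.proj i x = if j = i then x else 0 := by
  have h1 : (LinearEquiv.ofBijective (DirectSum.coeLinearMap ![D.U, D.Z, D.V, D.E])
      D.isInternal).symm x = DirectSum.of (fun i => ![D.U, D.Z, D.V, D.E] i) j ⟨x, hx⟩ := by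
    rw [LinearEquiv.symm_apply_eq]
    exact (DirectSum.coeLinearMap_of _ j ⟨x, hx⟩).symm
  simp only [proj, LinearMap.comp_apply, LinearEquiv.coe_coe, h1]
  split_ifs with h
  · subst h
    exact congrArg (fun z : ![D.U, D.Z, D.V, D.E] j => (z : L))
      (DirectSum.of_eq_same (β := fun i => ![D.U, D.Z, D.V, D.E] i) j ⟨x, hx⟩)
  · exact congrArg (fun z : ![D.U, D.Z, D.V, D.E] i => (z : L))
      (DirectSum.of_eq_of_ne (β := fun i => ![D.U, D.Z, D.V, D.E] i) j i ⟨x, hx⟩ (Ne.symm h))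

theorem iSup_eq_top : D.U ⊔ D.Z ⊔ D.V ⊔ D.E = ⊤ := by
  rw [eq_top_iff, ← D.isInternal.submodule_iSup_eq_top]
  refine iSup_le fun i => ?_
  fin_cases i
  · exact le_sup_left.trans (le_sup_left.trans le_sup_left)
  · exact le_sup_right.trans (le_sup_left.trans le_sup_left)
  · exact le_sup_right.trans le_sup_left
  · exact le_sup_right

theorem proj_add (x : L) : D.projU x + D.projZ x + D.projV x + D.projE x = x := by
  have h : x ∈ D.U ⊔ D.Z ⊔ D.V ⊔ D.E := D.iSup_eq_top ▸ Submodule.mem_top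
  obtain ⟨y₁, hy₁, e, he, rfl⟩ := Submodule.mem_sup.1 h
  obtain ⟨y₂, hy₂, v, hv, rfl⟩ := Submodule.mem_sup.1 hy₁
  obtain ⟨u, hu, z, hz, rfl⟩ := Submodule.mem_sup.1 hy₂
  simp only [projU, projZ, projV, projE, map_add, D.proj_of_mem (j := 0) hu,
    D.proj_of_mem (j := 1) hz, D.proj_of_mem (j := 2) hv, D.proj_of_mem (j := 3) he]
  simp

theorem U_le_center : D.U ≤ (LieAlgebra.center ℝ L).toSubmodule := D.center_eq ▸ le_sup_left

theorem Z_le_center : D.Z ≤ (LieAlgebra.center ℝ L).toSubmodule := D.center_eq ▸ le_sup_right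

theorem projU_add_projZ {x : L} (hx : x ∈ LieAlgebra.center ℝ L) : D.projU x + D.projZ x = x := by
  have h : x ∈ D.U ⊔ D.Z := D.center_eq ▸ hx
  obtain ⟨u, hu, z, hz, rfl⟩ := Submodule.mem_sup.1 h
  simp only [projU, projZ, map_add, D.proj_of_mem (j := 0) hu, D.proj_of_mem (j := 1) hz]
  simp

theorem apply_U_center (hBs : B.IsSymm) {u x : L} (hu : u ∈ D.U)
    (hx : x ∈ LieAlgebra.center ℝ L) : B u x = 0 := by
  rw [D.U_eq] at hu
  rw [hBs.eq]
  exact hu.2 x hx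

theorem apply_U_E {u e : L} (hu : u ∈ D.U) (he : e ∈ D.E) : B u e = 0 := by
  have h : e ∈ B.orthogonal D.U ⊓ B.orthogonal D.V := D.ZE_eq ▸ Submodule.mem_sup_right he
  exact h.1 u hu

theorem apply_V_E {v e : L} (hv : v ∈ D.V) (he : e ∈ D.E) : B v e = 0 := by
  have h : e ∈ B.orthogonal D.U ⊓ B.orthogonal D.V := D.ZE_eq ▸ Submodule.mem_sup_right he
  exact h.2 v hv

theorem apply_V_Z {v z : L} (hv : v ∈ D.V) (hz : z ∈ D.Z) : B v z = 0 := by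
  have h : z ∈ B.orthogonal D.U ⊓ B.orthogonal D.V := D.ZE_eq ▸ Submodule.mem_sup_left hz
  exact h.2 v hv

theorem apply_E_center (hBs : B.IsSymm) {e x : L} (he : e ∈ D.E)
    (hx : x ∈ LieAlgebra.center ℝ L) : B e x = 0 := by
  have h : x ∈ D.U ⊔ D.Z := D.center_eq ▸ hx
  obtain ⟨u, hu, z, hz, rfl⟩ := Submodule.mem_sup.1 h
  rw [map_add, hBs.eq e u, hBs.eq e z]
  rw [D.apply_U_E hu he, D.Z_perp_E z hz e he, add_zero]

/-- Pairing `a` with `𝔘` sees only its `𝔙`-component, which is orthogonal to the other three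
summands anyway; nondegeneracy kills it. With that gone, pairing with `𝔷'` sees only the
`𝔷'`-component, and the same argument applies. -/
theorem projV_eq_zero_and_projZ_eq_zero [FiniteDimensional ℝ L] (hBs : B.IsSymm)
    (hB : B.Nondegenerate) {a : L} (ha : ∀ x ∈ LieAlgebra.center ℝ L, B a x = 0) :
    D.projV a = 0 ∧ D.projZ a = 0 := by
  have hU := D.projU_mem a
  have hZ := D.projZ_mem a
  have hV := D.projV_mem a
  have hE := D.projE_mem a
  have ha' : ∀ x, B a x = B (D.projU a) x + B (D.projZ a) x + B (D.projV a) x + B (D.projE a) x := by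
    intro x
    conv_lhs => rw [← D.proj_add a]
    simp
  have ext : ∀ b : L, (∀ x ∈ D.U, B b x = 0) → (∀ x ∈ D.Z, B b x = 0) → (∀ x ∈ D.V, B b x = 0) →
      (∀ x ∈ D.E, B b x = 0) → b = 0 := by
    intro b h1 h2 h3 h4
    refine (B.toDual hB).injective (LinearMap.ext fun x => ?_)
    rw [map_zero, LinearMap.zero_apply, LinearMap.BilinForm.toDual_def, ← D.proj_add x]
    simp only [map_add, h1 _ (D.projU_mem x), h2 _ (D.projZ_mem x), h3 _ (D.projV_mem x),
      h4 _ (D.projE_mem x), add_zero]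
  have hv : D.projV a = 0 := by
    refine ext _ (fun x hx => ?_) (fun x hx => D.apply_V_Z hV hx) (fun x hx => D.V_null _ hV x hx)
      fun x hx => D.apply_V_E hV hx
    have h1 := ha' x
    rw [ha x (D.U_le_center hx), D.apply_U_center hBs hU (D.U_le_center hx),
      hBs.eq (D.projZ a), D.apply_U_center hBs hx (D.Z_le_center hZ), hBs.eq (D.projE a),
      D.apply_U_E hx hE] at h1
    linarith
  refine ⟨hv, ext _ (fun x hx => ?_) (fun x hx => ?_) (fun x hx => ?_)
    fun x hx => D.Z_perp_E _ hZ x hx⟩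
  · rw [hBs.eq, D.apply_U_center hBs hx (D.Z_le_center hZ)]
  · have h1 := ha' x
    rw [ha x (D.Z_le_center hx), D.apply_U_center hBs hU (D.Z_le_center hx), hv,
      hBs.eq (D.projE a), D.Z_perp_E x hx _ hE] at h1
    simpa using h1.symm
  · rw [hBs.eq, D.apply_V_Z hx hZ]

variable [FiniteDimensional ℝ L]

/-- For central `y`, `⟨ad†_x c, y⟩ = ⟨c, [x, y]⟩ = 0`, so only the `𝔘`- and `𝔈`-components survive.
-/
theorem opJ_add_opU (hBs : B.IsSymm) (hB : B.Nondegenerate) (c x : L) :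
    D.opJ hB c x + D.opU hB c x = adDagger B hB c x := by
  obtain ⟨h1, h2⟩ := D.projV_eq_zero_and_projZ_eq_zero hBs hB (a := adDagger B hB c x)
    fun y hy => by
      rw [adDagger_spec, (LieModule.mem_maxTrivSubmodule ℝ L L y).1 hy x, map_zero]
  conv_rhs => rw [← D.proj_add (adDagger B hB c x), h1, h2, add_zero, add_zero, add_comm]
  rfl

theorem opJ_mem (hB : B.Nondegenerate) (c x : L) : D.opJ hB c x ∈ D.E := D.projE_mem _

theorem opU_mem (hB : B.Nondegenerate) (c x : L) : D.opU hB c x ∈ D.U := D.projU_mem _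

theorem apply_opJ (hBs : B.IsSymm) (hB : B.Nondegenerate) (c x : L) {y : L} (hy : y ∈ D.E) :
    B (D.opJ hB c x) y = B c ⁅x, y⁆ := by
  rw [← adDagger_spec B hB, ← D.opJ_add_opU hBs hB, map_add, LinearMap.add_apply,
    D.apply_U_E (D.opU_mem hB c x) hy, add_zero]

theorem apply_opJ_skew (hBs : B.IsSymm) (hB : B.Nondegenerate) (c : L) {x y : L} (hx : x ∈ D.E)
    (hy : y ∈ D.E) : B (D.opJ hB c x) y = -B (D.opJ hB c y) x := by
  rw [D.apply_opJ hBs hB c x hy, D.apply_opJ hBs hB c y hx, ← lie_skew, map_neg]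

/-- `J` is skew on `𝔈`, so its image is orthogonal to its kernel. -/
theorem opJ_mem_E₂ (hBs : B.IsSymm) (hB : B.Nondegenerate) (c : L) {x : L} (hx : x ∈ D.E) :
    D.opJ hB c x ∈ D.E₂ hB c := by
  refine ⟨D.opJ_mem hB c x, fun k hk => ?_⟩
  have h1 : D.opJ hB c k = 0 := hk.2
  change B k (D.opJ hB c x) = 0
  rw [hBs.eq, D.apply_opJ_skew hBs hB c hx hk.1, h1]
  simp

theorem eq_zero_of_mem_E (hBs : B.IsSymm) (hB : B.Nondegenerate) {x : L} (hx : x ∈ D.E)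
    (h : ∀ y ∈ D.E, B x y = 0) : x = 0 := by
  refine (B.toDual hB).injective (LinearMap.ext fun y => ?_)
  rw [map_zero, LinearMap.zero_apply, LinearMap.BilinForm.toDual_def, ← D.proj_add y]
  simp only [map_add, h _ (D.projE_mem y), hBs.eq x (D.projU y), hBs.eq x (D.projZ y),
    hBs.eq x (D.projV y), D.apply_U_E (D.projU_mem y) hx, D.Z_perp_E _ (D.projZ_mem y) x hx,
    D.apply_V_E (D.projV_mem y) hx, add_zero]

/-- An element of `𝔈₂` in the kernel of `J` also lies in `𝔈₁`, so it is orthogonal to `𝔈₁ + 𝔈₂ = 𝔈`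
and vanishes, the form being nondegenerate on `𝔈`. In finite dimension injectivity suffices. -/
theorem bijOn_opJ (hBs : B.IsSymm) (hB : B.Nondegenerate) (c : L)
    (h : D.E₁ hB c ⊔ D.E₂ hB c = D.E) :
    Set.BijOn (D.opJ hB c) (D.E₂ hB c) (D.E₂ hB c) := by
  have hmaps : ∀ x ∈ D.E₂ hB c, D.opJ hB c x ∈ D.E₂ hB c := fun x hx =>
    D.opJ_mem_E₂ hBs hB c hx.1
  have hker : ∀ x ∈ D.E₂ hB c, D.opJ hB c x = 0 → x = 0 := by
    intro x hx hx0
    refine D.eq_zero_of_mem_E hBs hB hx.1 fun y hy => ?_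
    rw [← h] at hy
    obtain ⟨k, hk, y₂, hy₂, rfl⟩ := Submodule.mem_sup.1 hy
    have h1 : B k x = 0 := hx.2 k hk
    have h2 : B x y₂ = 0 := hy₂.2 x ⟨hx.1, hx0⟩
    rw [map_add, hBs.eq x k, h1, h2, add_zero]
  let T : D.E₂ hB c →ₗ[ℝ] D.E₂ hB c := (D.opJ hB c).restrict hmaps
  have hT : Function.Injective T := by
    rw [← LinearMap.ker_eq_bot, LinearMap.ker_eq_bot']
    intro x hx
    exact Subtype.ext (hker x x.2 (congrArg Subtype.val hx))
  refine ⟨hmaps, fun x hx y hy hxy => ?_, fun y hy => ?_⟩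
  · exact congrArg Subtype.val (hT (Subtype.ext hxy : T ⟨x, hx⟩ = T ⟨y, hy⟩))
  · obtain ⟨x, hx⟩ := LinearMap.surjective_of_injective hT ⟨y, hy⟩
    exact ⟨x, x.2, congrArg Subtype.val hx⟩

end NullSplitting

/-! ### From the Euler–Arnold equation to geodesics; completeness -/

section Solutions

open Filter Topology

variable {E : Type*} [NormedAddCommGroup E] [NormedSpace ℝ E] [FiniteDimensional ℝ E]
  {N : Type*} [TopologicalSpace N] [ChartedSpace E N] [Group N] [LieGroup 𝓘(ℝ, E) ∞ N]
  [T2Space N] {B : BilinForm ℝ (GroupLieAlgebra 𝓘(ℝ, E) N)}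

/-- In a 2-step nilpotent Lie algebra, `ẏ - ½ [y, ẏ]` and the initial value determine `y`. -/
theorem eqOn_of_sub_groupBracket_eq
    (h2 : ∀ X Y Z : E, groupBracket E N X (groupBracket E N Y Z) = 0) {y z : ℝ → E} {s : Set ℝ}
    (hs : IsOpen s) (hs' : IsPreconnected s) (hy : ∀ t ∈ s, DifferentiableAt ℝ y t)
    (hz : ∀ t ∈ s, DifferentiableAt ℝ z t)
    (h : ∀ t ∈ s, deriv y t - (1 / 2 : ℝ) • groupBracket E N (y t) (deriv y t) =
      deriv z t - (1 / 2 : ℝ) • groupBracket E N (z t) (deriv z t)) {t₀ : ℝ} (ht₀ : t₀ ∈ s)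
    (h₀ : y t₀ = z t₀) : ∀ t ∈ s, y t = z t := by
  have hd : ∀ t ∈ s, HasDerivAt (fun t => y t - z t) (deriv y t - deriv z t) t := fun t ht =>
    (hy t ht).hasDerivAt.sub (hz t ht).hasDerivAt
  -- By hypothesis `ẏ - ż` is a combination of brackets, hence central; integrating, so is `y - z`.
  -- Therefore `[y, ẏ] = [z, ż]`, and the hypothesis reduces to `ẏ = ż`.
  have hc : ∀ X, ∀ t ∈ s, groupBracket E N X (deriv y t - deriv z t) = 0 := by
    intro X t ht
    have h1 : deriv y t - deriv z t = (1 / 2 : ℝ) • groupBracket E N (y t) (deriv y t) -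
        (1 / 2 : ℝ) • groupBracket E N (z t) (deriv z t) := by
      exact sub_eq_sub_iff_sub_eq_sub.1 (h t ht)
    rw [h1]
    simp [h2]
  have hc' : ∀ X, ∀ t ∈ s, groupBracket E N X (y t - z t) = 0 := by
    intro X t ht
    have hd' : ∀ t ∈ s, HasDerivAt (fun t => groupBracket E N X (y t - z t)) 0 t := by
      intro t ht
      have := (groupBracket E N X).hasFDerivAt.comp_hasDerivAt t (hd t ht)
      rwa [hc X t ht] at this
    have := hs.is_const_of_deriv_eq_zero hs'
      (fun t ht => (hd' t ht).differentiableAt.differentiableWithinAt)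
      (fun t ht => (hd' t ht).deriv) ht ht₀
    simpa [h₀] using this
  have hd0 : ∀ t ∈ s, deriv y t - deriv z t = 0 := by
    intro t ht
    have h1 := hc (y t) t ht
    have h3 := hc' (deriv z t) t ht
    rw [map_sub, sub_eq_zero] at h1 h3
    have h4 := h t ht
    rw [h1, groupBracket_skew, h3, ← groupBracket_skew] at h4
    exact sub_eq_zero.2 (sub_left_injective h4)
  intro t ht
  have h1 := hs.is_const_of_deriv_eq_zero hs'
    (fun t ht => (hd t ht).differentiableAt.differentiableWithinAt)
    (fun t ht => (hd t ht).deriv.trans (hd0 t ht)) ht ht₀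
  rw [h₀, sub_self] at h1
  exact sub_eq_zero.1 h1

theorem solvesGeodesicEquations_of_eulerArnold (hBs : B.IsSymm) (hB : B.Nondegenerate)
    (h2 : ∀ X Y Z : E, groupBracket E N X (groupBracket E N Y Z) = 0) {y ξ ξ' : ℝ → E} {w : E}
    (hy : ContDiff ℝ 2 y) (hy0 : y 0 = 0) (hyw : deriv y 0 = w)
    (hyξ : ∀ t, deriv y t - (1 / 2 : ℝ) • groupBracket E N (y t) (deriv y t) = ξ t)
    (hξ : ∀ t, HasDerivAt ξ (ξ' t) t)
    (h : ∀ t, ∀ w : E, groupForm B (ξ' t) w = groupForm B (ξ t) (groupBracket E N (ξ t) w)) :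
    SolvesGeodesicEquations (leftInvariantMetric B) w y := by
  have hexp : ∀ t, MDifferentiableAt 𝓘(ℝ, ℝ) 𝓘(ℝ, E) (fun t => groupExp N (y t)) t ∧
      leftLogDeriv E (fun t => groupExp N (y t)) t 1 = ξ t := by
    intro t
    rw [← hyξ]
    exact leftLogDeriv_groupExp_comp h2 (hy.differentiable (by simp) t).hasDerivAt
  have hξ1 : ContDiff ℝ 1 ξ := by
    have h1 : ContDiff ℝ 1 (deriv y) := (contDiff_succ_iff_deriv.1
      (show ContDiff ℝ (1 + 1) y from hy)).2.2
    have h3 : ContDiff ℝ 1 (fun t => groupBracket E N (y t)) :=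
      (groupBracket E N).contDiff.comp (hy.of_le (by norm_num))
    rw [← funext hyξ]
    exact h1.sub (contDiff_const.smul (h3.clm_apply h1))
  have hgeo : IsGeodesicOn (leftInvariantMetric B) (fun t => groupExp N (y t)) Set.univ :=
    isGeodesicOn_leftInvariantMetric hBs isOpen_univ (fun t _ => (hexp t).1)
      (fun t _ => (hexp t).2) hξ1.contDiffOn (fun t _ => hξ t) fun t _ => h t
  have hξ0 : ξ 0 = w := by
    rw [← hyξ 0, hy0, hyw]
    simp
  have huniq : ∀ s : Set ℝ, IsOpen s → IsPreconnected s → (0 : ℝ) ∈ s → ∀ γ : ℝ → N,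
      IsGeodesicOn (leftInvariantMetric B) γ s → γ 0 = 1 → leftLogDeriv E γ 0 1 = w →
        ∀ t ∈ s, γ t = groupExp N (y t) := by
    intro s hs hs' h0 γ hγ hγ0 hγ1
    refine hγ.eqOn hBs hB h2 hs hs' ⟨hgeo.contMDiffOn.mono (Set.subset_univ s),
      fun t _ => hgeo.equation t (Set.mem_univ t)⟩ h0 ?_ ?_
    · rw [hγ0, hy0, groupExp_zero]
    · rw [hγ1, (hexp 0).2, hξ0]
  have huniqc : ∀ s : Set ℝ, IsOpen s → IsPreconnected s → (0 : ℝ) ∈ s → ∀ z : ℝ → E,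
      ContDiffOn ℝ 2 z s → z 0 = 0 → deriv z 0 = w →
        IsGeodesicOn (leftInvariantMetric B) (fun t => groupExp N (z t)) s →
          ∀ t ∈ s, z t = y t := by
    intro s hs hs' h0 z hz hz0 hzw hzg
    have hzd : ∀ t ∈ s, DifferentiableAt ℝ z t := fun t ht =>
      (hz.contDiffAt (hs.mem_nhds ht)).differentiableAt (by simp)
    have hzexp := fun t ht => leftLogDeriv_groupExp_comp h2 (hzd t ht).hasDerivAt
    have h1 : leftLogDeriv E (fun t => groupExp N (z t)) 0 1 = w := by
      rw [(hzexp 0 h0).2, hz0, hzw]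
      simp
    have h3 := huniq s hs hs' h0 (fun t => groupExp N (z t)) hzg
      ((congrArg (groupExp N) hz0).trans groupExp_zero) h1
    -- Equality of the exponentials gives equality of their logarithmic derivatives, and these
    -- determine the coordinate curve.
    refine eqOn_of_sub_groupBracket_eq h2 hs hs' hzd
      (fun t _ => hy.differentiable (by simp) t) (fun t ht => ?_) h0 (hz0.trans hy0.symm)
    rw [hyξ, ← (hexp t).2]
    refine (hzexp t ht).2.symm.trans ?_
    have h4 : (fun t => groupExp N (z t)) =ᶠ[𝓝 t] fun t => groupExp N (y t) := by
      filter_upwards [hs.mem_nhds ht] with τ hτ using h3 τ hτ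
    rw [h4.leftLogDeriv_eq]
  refine ⟨hy, hy0, hyw, hgeo, ?_, ?_, huniqc⟩
  · refine velocity_eq_iff.2 ⟨?_, ?_⟩
    · exact (congrArg (groupExp N) hy0).trans groupExp_zero
    · exact ((hexp 0).2.trans hξ0).trans (leftTrivialization_one (E := E) (N := N) w).symm
  · intro s hs hs' h0 γ hγ hv
    obtain ⟨h1, h3⟩ := velocity_eq_iff.1 hv
    exact huniq s hs hs' h0 γ hγ h1 (h3.trans (leftTrivialization_one (E := E) (N := N) w))

theorem hasDerivAt_intervalIntegral {f : ℝ → E} (hf : Continuous f) (t : ℝ) :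
    HasDerivAt (fun t => ∫ s in (0 : ℝ)..t, f s) (f t) t :=
  (hf.integral_hasStrictDerivAt 0 t).hasDerivAt

theorem isGeodesicallyComplete_leftInvariantMetric (hBs : B.IsSymm) (hB : B.Nondegenerate)
    (h2 : ∀ X Y Z : E, groupBracket E N X (groupBracket E N Y Z) = 0) :
    IsGeodesicallyComplete (leftInvariantMetric B) := by
  rintro ⟨p, v⟩
  let w : E := leftTrivialization p v
  let T : E →L[ℝ] E := adDaggerCLM hB w
  let ξ : ℝ → E := fun t => NormedSpace.exp (t • T) w
  have hξ : ∀ t, HasDerivAt ξ (T (ξ t)) t := fun t =>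
    ((hasDerivAt_exp_smul_const' T t).clm_apply (hasDerivAt_const t w)).congr_deriv (by simp [ξ])
  have hξ0 : ξ 0 = w := by simp [ξ]
  have hξc : Continuous ξ := continuous_iff_continuousAt.2 fun t => (hξ t).continuousAt
  -- The solution of the linear equation satisfies the conservation law too, so it solves the
  -- Euler–Arnold equation itself.
  have hcons : ∀ X Y t, groupForm B (ξ t) (groupBracket E N X Y) =
      groupForm B w (groupBracket E N X Y) := by
    intro X Y t
    have hd : ∀ t, HasDerivAt (fun t => groupForm B (ξ t) (groupBracket E N X Y)) 0 t := by
      intro t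
      refine (((groupForm B).hasFDerivAt.comp_hasDerivAt t (hξ t)).clm_apply
        (hasDerivAt_const t (groupBracket E N X Y))).congr_deriv ?_
      simp [T, groupForm_adDaggerCLM, h2]
    have := is_const_of_deriv_eq_zero (fun t => (hd t).differentiableAt) (fun t => (hd t).deriv) t 0
    rwa [hξ0] at this
  let X : ℝ → E := fun t => ∫ s in (0 : ℝ)..t, ξ s
  have hX : ∀ t, HasDerivAt X (ξ t) t := hasDerivAt_intervalIntegral hξc
  have hXc : Continuous X := continuous_iff_continuousAt.2 fun t => (hX t).continuousAt
  have hbc : Continuous fun t => groupBracket E N (X t) (ξ t) :=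
    ((groupBracket E N).continuous.comp hXc).clm_apply hξc
  let Y : ℝ → E := fun t => ∫ s in (0 : ℝ)..t, groupBracket E N (X s) (ξ s)
  have hY : ∀ t, HasDerivAt Y (groupBracket E N (X t) (ξ t)) t := hasDerivAt_intervalIntegral hbc
  have hYc : ∀ Z t, groupBracket E N Z (Y t) = 0 := by
    intro Z t
    have h1 := (groupBracket E N Z).intervalIntegral_comp_comm
      (hbc.intervalIntegrable (μ := MeasureTheory.volume) 0 t)
    rw [← h1]
    simp [h2]
  -- Since `Y` is central, `[y, ·] = [X, ·]`. The term `½Y` then cancels the bracket in `ẏ - ½[y,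
  -- ẏ]`, which becomes `ξ`.
  let y : ℝ → E := fun t => X t + (1 / 2 : ℝ) • Y t
  have hy : ∀ t, HasDerivAt y (ξ t + (1 / 2 : ℝ) • groupBracket E N (X t) (ξ t)) t := fun t =>
    (hX t).add ((hY t).const_smul _)
  have hyξ : ∀ t, (ξ t + (1 / 2 : ℝ) • groupBracket E N (X t) (ξ t)) - (1 / 2 : ℝ) •
      groupBracket E N (y t) (ξ t + (1 / 2 : ℝ) • groupBracket E N (X t) (ξ t)) = ξ t := by
    intro t
    have h1 : groupBracket E N (Y t) (ξ t) = 0 := by rw [groupBracket_skew, hYc, neg_zero]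
    simp [y, h2, h1]
  have hy0 : y 0 = 0 := by simp [y, X, Y]
  let γ : ℝ → N := fun t => p * groupExp N (y t)
  have hγ : ∀ t, MDifferentiableAt 𝓘(ℝ, ℝ) 𝓘(ℝ, E) γ t ∧ leftLogDeriv E γ t 1 = ξ t := by
    intro t
    obtain ⟨h1, h3⟩ := leftLogDeriv_groupExp_comp h2 (hy t)
    refine ⟨(mdifferentiableAt_const_mul p _).comp t h1, ?_⟩
    rw [leftLogDeriv_mul_left p h1, h3, hyξ]
  refine ⟨γ, isGeodesicOn_leftInvariantMetric hBs isOpen_univ (fun t _ => (hγ t).1)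
    (fun t _ => (hγ t).2) ?_ (fun t _ => hξ t) fun t _ W => ?_, velocity_eq_iff.2 ⟨?_, ?_⟩⟩
  · refine ContDiff.contDiffOn (contDiff_one_iff_deriv.2
      ⟨fun t => (hξ t).differentiableAt, ?_⟩)
    rw [funext fun t => (hξ t).deriv]
    exact T.continuous.comp hξc
  · rw [groupForm_adDaggerCLM, hcons]
  · simp [γ, hy0, groupExp_zero]
  · exact (hγ 0).2.trans hξ0

end Solutions

/-! ### The geodesic coordinates solve the Euler–Arnold equation -/

section Coordinates

variable {E : Type*} [NormedAddCommGroup E] [NormedSpace ℝ E] [FiniteDimensional ℝ E]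
  {N : Type*} [TopologicalSpace N] [ChartedSpace E N] [Group N] [LieGroup 𝓘(ℝ, E) ∞ N]
  {B : BilinForm ℝ (GroupLieAlgebra 𝓘(ℝ, E) N)}

theorem ContDiff.of_hasDerivAt {n : WithTop ℕ∞} (hn : n ≠ ω) {f f' : ℝ → E}
    (h : ∀ t, HasDerivAt f (f' t) t) (hf' : ContDiff ℝ n f') : ContDiff ℝ (n + 1) f := by
  refine contDiff_succ_iff_deriv.2 ⟨fun t => (h t).differentiableAt, fun h => absurd h hn, ?_⟩
  rwa [funext fun t => (h t).deriv]

theorem mem_center_iff_groupBracket {X : GroupLieAlgebra 𝓘(ℝ, E) N} :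
    X ∈ LieAlgebra.center ℝ (GroupLieAlgebra 𝓘(ℝ, E) N) ↔ ∀ Y : E, groupBracket E N Y X = 0 :=
  LieModule.mem_maxTrivSubmodule ℝ _ _ X

/-- A linear endomorphism of the Lie algebra as a continuous linear map. -/
noncomputable def groupEnd (T : GroupLieAlgebra 𝓘(ℝ, E) N →ₗ[ℝ] GroupLieAlgebra 𝓘(ℝ, E) N) :
    E →L[ℝ] E :=
  LinearMap.toContinuousLinearMap (E := E) (F' := E) T

theorem groupBracket_integral_eq_zero {X : E} {f : ℝ → E} (hf : Continuous f)
    (h : ∀ s, groupBracket E N X (f s) = 0) (t : ℝ) :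
    groupBracket E N X (∫ s in (0 : ℝ)..t, f s) = 0 := by
  have h1 := (groupBracket E N X).intervalIntegral_comp_comm
    (hf.intervalIntegrable (μ := MeasureTheory.volume) 0 t)
  rw [← h1]
  simp [h]

theorem bracketIntegral_eq {x x' : ℝ → E} (hx : ∀ t, HasDerivAt x (x' t) t) (t : ℝ) :
    bracketIntegral (E := E) (N := N) x t =
      (-(1 / 2 : ℝ) • ∫ s in (0 : ℝ)..t, groupBracket E N (x' s) (x s) : E) := by
  have h : deriv x = x' := funext fun t => (hx t).deriv
  subst h
  rfl

/-- The bracket integral is central, so its `𝔘`- and `𝔷'`-parts add up to all of it; as `x 0 = 0`,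
the inner integral of the `𝔘`-operator along the velocity is that operator applied to `x`. -/
theorem geodesicCoordinates_eq (D : NullSplitting B) (hB : B.Nondegenerate)
    (h2 : ∀ X Y Z : E, groupBracket E N X (groupBracket E N Y Z) = 0)
    {u₀ z₀ v₀ : E} {x x' : ℝ → E} (hx : ∀ t, HasDerivAt x (x' t) t) (hx' : Continuous x')
    (hx0 : x 0 = 0) (t : ℝ) :
    geodesicCoordinates D hB u₀ z₀ v₀ x t =
      (x t + t • (z₀ + u₀) + -(1 / 2 : ℝ) • (∫ s in (0 : ℝ)..t, groupBracket E N (x' s) (x s)) +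
        ∫ s in (0 : ℝ)..t, groupEnd (D.opU hB (z₀ + v₀ : E)) (x s) : E) := by
  have hxc : Continuous x := continuous_iff_continuousAt.2 fun t => (hx t).continuousAt
  have hbc : Continuous fun t => groupBracket E N (x' t) (x t) :=
    ((groupBracket E N).continuous.comp hx').clm_apply hxc
  have hd : deriv x = x' := funext fun t => (hx t).deriv
  let I : E := -(1 / 2 : ℝ) • ∫ s in (0 : ℝ)..t, groupBracket E N (x' s) (x s)
  have hI : D.projU I + D.projZ I = I := by
    refine D.projU_add_projZ (mem_center_iff_groupBracket.2 fun Y => ?_)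
    rw [map_smul, groupBracket_integral_eq_zero hbc (fun s => h2 _ _ _), smul_zero]
  have hin : ∀ s : ℝ, (∫ σ in (0 : ℝ)..s, groupEnd (D.opU hB (z₀ + v₀ : E)) (x' σ)) =
      groupEnd (D.opU hB (z₀ + v₀ : E)) (x s) := by
    intro s
    rw [intervalIntegral.integral_eq_sub_of_hasDerivAt
      (f := fun s => groupEnd (D.opU hB (z₀ + v₀ : E)) (x s))
      (fun σ _ => (groupEnd (D.opU hB (z₀ + v₀ : E))).hasFDerivAt.comp_hasDerivAt σ (hx σ))
      (((groupEnd (D.opU hB (z₀ + v₀ : E))).continuous.comp hx').intervalIntegrable 0 s), hx0,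
      map_zero, sub_zero]
  have e1 : geodesicCoordinates D hB u₀ z₀ v₀ x t =
      (x t + (t • z₀ + groupEnd D.projZ I) + (t • u₀ + groupEnd D.projU I + ∫ s in (0 : ℝ)..t,
        ∫ σ in (0 : ℝ)..s, groupEnd (D.opU hB (z₀ + v₀ : E)) (x' σ)) : E) := by
    subst hd
    rfl
  rw [e1, funext hin]
  have h : ∀ a b d i : E, a + b = i →
      x t + (t • z₀ + b) + (t • u₀ + a + d) = x t + t • (z₀ + u₀) + i + d := by
    rintro a b d i rfl
    module
  exact h _ _ _ _ hI

/-- The logarithmic derivative of the curve is `ẋ + z₀ + u₀ + T x`, with `T` the `𝔘`-part of `ad†`.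
Its derivative is `J ẋ + T ẋ = ad†_ẋ (z₀ + v₀)`. -/
theorem solvesGeodesicEquations_geodesicCoordinates [T2Space N] (hBs : B.IsSymm)
    (hB : B.Nondegenerate) (h2 : ∀ X Y Z : E, groupBracket E N X (groupBracket E N Y Z) = 0)
    (D : NullSplitting B) {u₀ z₀ v₀ e₀ : E} (hu : (u₀ : GroupLieAlgebra 𝓘(ℝ, E) N) ∈ D.U)
    (hz : (z₀ : GroupLieAlgebra 𝓘(ℝ, E) N) ∈ D.Z)
    {x x' : ℝ → E} (hx : ∀ t, HasDerivAt x (x' t) t)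
    (hx' : ∀ t, HasDerivAt x' (groupEnd (D.opJ hB (z₀ + v₀ : E)) (x' t)) t) (hx0 : x 0 = 0)
    (hx'0 : x' 0 = v₀ + e₀)
    (hE : ∀ t, ((x' t - v₀ : E) : GroupLieAlgebra 𝓘(ℝ, E) N) ∈ D.E) :
    SolvesGeodesicEquations (leftInvariantMetric B) (u₀ + z₀ + v₀ + e₀ : E)
      (geodesicCoordinates D hB u₀ z₀ v₀ x) := by
  have hx'c : Continuous x' := continuous_iff_continuousAt.2 fun t => (hx' t).continuousAt
  have hxc : Continuous x := continuous_iff_continuousAt.2 fun t => (hx t).continuousAt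
  have hbc : Continuous fun t => groupBracket E N (x' t) (x t) :=
    ((groupBracket E N).continuous.comp hx'c).clm_apply hxc
  let T : E →L[ℝ] E := groupEnd (D.opU hB (z₀ + v₀ : E))
  let J : E →L[ℝ] E := groupEnd (D.opJ hB (z₀ + v₀ : E))
  have hTc : Continuous fun t => T (x t) := T.continuous.comp hxc
  have hx'1 : ContDiff ℝ 1 x' := by
    simpa using ContDiff.of_hasDerivAt (n := 0) (by simp) hx'
      (contDiff_zero.2 (J.continuous.comp hx'c))
  have hx1 : ContDiff ℝ 1 x := by
    simpa using ContDiff.of_hasDerivAt (n := 0) (by simp) hx (contDiff_zero.2 hx'c)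
  let y : ℝ → E := fun t => x t + t • (z₀ + u₀) +
    -(1 / 2 : ℝ) • (∫ s in (0 : ℝ)..t, groupBracket E N (x' s) (x s)) + ∫ s in (0 : ℝ)..t, T (x s)
  let y' : ℝ → E := fun t => x' t + (z₀ + u₀) + -(1 / 2 : ℝ) • groupBracket E N (x' t) (x t) +
    T (x t)
  have hy : ∀ t, HasDerivAt y (y' t) t := fun t =>
    (((hx t).add ((hasDerivAt_id t).smul_const (z₀ + u₀))).add
      ((hasDerivAt_intervalIntegral hbc t).const_smul _)).add
        (hasDerivAt_intervalIntegral hTc t) |>.congr_deriv (by simp [y'])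
  have hy'1 : ContDiff ℝ 1 y' :=
    ((hx'1.add contDiff_const).add (contDiff_const.smul
      (((groupBracket E N).contDiff.comp hx'1).clm_apply hx1))).add (T.contDiff.comp hx1)
  have hy2 : ContDiff ℝ 2 y := by
    have h := ContDiff.of_hasDerivAt (n := 1) (by simp) hy hy'1
    rwa [one_add_one_eq_two] at h
  have hy0 : y 0 = 0 := by simp [y, hx0]
  have hcu : ∀ Y : E, groupBracket E N Y u₀ = 0 := mem_center_iff_groupBracket.1 (D.U_le_center hu)
  have hcz : ∀ Y : E, groupBracket E N Y z₀ = 0 := mem_center_iff_groupBracket.1 (D.Z_le_center hz)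
  have hcT : ∀ X Y : E, groupBracket E N Y (T X) = 0 := fun X =>
    mem_center_iff_groupBracket.1 (D.U_le_center (D.opU_mem hB _ X))
  have hcI : ∀ Y t, groupBracket E N Y (∫ s in (0 : ℝ)..t, groupBracket E N (x' s) (x s)) = 0 :=
    fun Y => groupBracket_integral_eq_zero hbc fun s => h2 _ _ _
  have hcI' : ∀ Y t, groupBracket E N Y (∫ s in (0 : ℝ)..t, T (x s)) = 0 :=
    fun Y => groupBracket_integral_eq_zero hTc fun s => hcT _ _
  have hw : ∀ t Y, groupBracket E N Y (y t) = groupBracket E N Y (x t) := by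
    intro t Y
    simp [y, hcu, hcz, hcI, hcI']
  have hw' : ∀ t Y, groupBracket E N Y (y' t) = groupBracket E N Y (x' t) := by
    intro t Y
    simp [y', hcu, hcz, hcT, h2]
  have hyξ : ∀ t, y' t - (1 / 2 : ℝ) • groupBracket E N (y t) (y' t) =
      x' t + (z₀ + u₀) + T (x t) := by
    intro t
    rw [hw', groupBracket_skew (y t), hw]
    simp only [y']
    module
  -- Brackets see only `ẋ`. Against the central element `[ẋ, w]`, the terms `u₀` and `T x` in `𝔘`
  -- and `ẋ - v₀` in `𝔈` pair to zero, so only `z₀ + v₀` remains.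
  have hEA : ∀ t, ∀ w : E, groupForm B (J (x' t) + T (x' t)) w =
      groupForm B (x' t + (z₀ + u₀) + T (x t))
        (groupBracket E N (x' t + (z₀ + u₀) + T (x t)) w) := by
    intro t w
    have h1 : groupBracket E N (x' t + (z₀ + u₀) + T (x t)) w = groupBracket E N (x' t) w := by
      rw [groupBracket_skew _ w, groupBracket_skew _ w]
      simp [hcu, hcz, hcT]
    have hζ : (groupBracket E N (x' t) w : GroupLieAlgebra 𝓘(ℝ, E) N) ∈
        LieAlgebra.center ℝ (GroupLieAlgebra 𝓘(ℝ, E) N) :=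
      mem_center_iff_groupBracket.2 fun Y => h2 _ _ _
    have h3 : groupForm B (J (x' t) + T (x' t)) w =
        groupForm B (z₀ + v₀) (groupBracket E N (x' t) w) := by
      have h4 : J (x' t) + T (x' t) = adDagger B hB (z₀ + v₀ : E) (x' t) :=
        D.opJ_add_opU hBs hB _ _
      rw [h4]
      exact adDagger_spec B hB _ _ _
    have h5 : groupForm B u₀ (groupBracket E N (x' t) w) = 0 := D.apply_U_center hBs hu hζ
    have h6 : groupForm B (T (x t)) (groupBracket E N (x' t) w) = 0 :=
      D.apply_U_center hBs (D.opU_mem hB _ _) hζ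
    have h7 : groupForm B (x' t - v₀) (groupBracket E N (x' t) w) = 0 :=
      D.apply_E_center hBs (hE t) hζ
    rw [h1, h3]
    rw [map_sub, _root_.sub_apply] at h7
    simp only [map_add, _root_.add_apply, h5, h6]
    linarith
  have hT0 : T 0 = 0 := map_zero T
  have hyw : deriv y 0 = u₀ + z₀ + v₀ + e₀ := by
    rw [(hy 0).deriv]
    simp only [y', hx0, hx'0, map_zero]
    module
  have key := solvesGeodesicEquations_of_eulerArnold hBs hB h2 hy2 hy0 hyw
    (fun t => by rw [(hy t).deriv]; exact hyξ t)
    (fun t => ((hx' t).add_const (z₀ + u₀)).add (T.hasFDerivAt.comp_hasDerivAt t (hx t))) hEA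
  have hfun : y = geodesicCoordinates D hB u₀ z₀ v₀ x :=
    funext fun t => (geodesicCoordinates_eq D hB h2 hx hx'c hx0 t).symm
  exact hfun ▸ key

end Coordinates

/-! ### Exponentials of operators applied to vectors -/

section Exponential

variable {E : Type*} [NormedAddCommGroup E] [NormedSpace ℝ E] [FiniteDimensional ℝ E]

theorem eq_of_hasDerivAt_eq {f g f' : ℝ → E} (hf : ∀ t, HasDerivAt f (f' t) t)
    (hg : ∀ t, HasDerivAt g (f' t) t) (h0 : f 0 = g 0) (t : ℝ) : f t = g t := by
  have h : ∀ t, HasDerivAt (fun t => f t - g t) 0 t := fun t =>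
    ((hf t).sub (hg t)).congr_deriv (sub_self _)
  have := is_const_of_deriv_eq_zero (fun t => (h t).differentiableAt) (fun t => (h t).deriv) t 0
  rw [h0, sub_self] at this
  exact sub_eq_zero.1 this

theorem hasDerivAt_exp_smul_apply (J : E →L[ℝ] E) (X : E) (t : ℝ) :
    HasDerivAt (fun t : ℝ => NormedSpace.exp (t • J) X) (J (NormedSpace.exp (t • J) X)) t :=
  ((hasDerivAt_exp_smul_const' J t).clm_apply (hasDerivAt_const t X)).congr_deriv (by simp)

theorem hasDerivAt_exp_smul_apply' (J : E →L[ℝ] E) {X Y : E} (h : J X = Y) (t : ℝ) :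
    HasDerivAt (fun t : ℝ => NormedSpace.exp (t • J) X) (NormedSpace.exp (t • J) Y) t := by
  refine ((hasDerivAt_exp_smul_const J t).clm_apply (hasDerivAt_const t X)).congr_deriv ?_
  simp [h]

theorem continuous_exp_smul_apply (J : E →L[ℝ] E) (X : E) :
    Continuous fun t : ℝ => NormedSpace.exp (t • J) X :=
  continuous_iff_continuousAt.2 fun t => (hasDerivAt_exp_smul_apply J X t).continuousAt

theorem integral_exp_smul_apply (J : E →L[ℝ] E) (X : E) (t : ℝ) :
    ∫ s in (0 : ℝ)..t, NormedSpace.exp (s • J) (J X) = NormedSpace.exp (t • J) X - X := by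
  rw [intervalIntegral.integral_eq_sub_of_hasDerivAt
    (fun s _ => hasDerivAt_exp_smul_apply' J rfl s)
    ((continuous_exp_smul_apply J _).intervalIntegrable 0 t)]
  simp

end Exponential

/-! ### The bracket integral in closed form -/

section Explicit

variable {E : Type*} [NormedAddCommGroup E] [NormedSpace ℝ E] [FiniteDimensional ℝ E]
  {N : Type*} [TopologicalSpace N] [ChartedSpace E N] [Group N] [LieGroup 𝓘(ℝ, E) ∞ N]

theorem HasDerivAt.groupBracket {f g : ℝ → E} {f' g' : E} {t : ℝ} (hf : HasDerivAt f f' t)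
    (hg : HasDerivAt g g' t) :
    HasDerivAt (fun t => _root_.groupBracket E N (f t) (g t))
      (_root_.groupBracket E N f' (g t) + _root_.groupBracket E N (f t) g') t :=
  ((_root_.groupBracket E N).hasFDerivAt.comp_hasDerivAt t hf).clm_apply hg

/-- The vectors `k`, `l`, `m` play the roles of `J⁻¹x₂`, `J⁻²x₂`, `J⁻³x₂`, so `J` need not be
invertible. Both sides vanish at `0`, and their derivatives agree by bilinearity and skew-symmetry
alone. -/
theorem integral_groupBracket_explicit (J : E →L[ℝ] E) {x₁ y₁ x₂ k l m : E} (hk : J k = x₂)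
    (hl : J l = k) (hm : J m = l) (t : ℝ) :
    -(1 / 2 : ℝ) • ∫ s in (0 : ℝ)..t,
        groupBracket E N (x₁ + NormedSpace.exp (s • J) x₂ + s • y₁)
          (s • x₁ + (NormedSpace.exp (s • J) k - k) + (1 / 2 * s ^ 2 : ℝ) • y₁) =
      (1 / 2 * t : ℝ) • groupBracket E N (x₁ + (1 / 2 * t : ℝ) • y₁)
          (NormedSpace.exp (t • J) k + k)
        - t • groupBracket E N y₁ (NormedSpace.exp (t • J) l)
        + (1 / 12 * t ^ 3 : ℝ) • groupBracket E N x₁ y₁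
        + (1 / 2 : ℝ) • groupBracket E N (NormedSpace.exp (t • J) k - k) k
        - groupBracket E N x₁ (NormedSpace.exp (t • J) l - l)
        + groupBracket E N y₁ (NormedSpace.exp (t • J) m - m)
        + (1 / 2 : ℝ) • ∫ s in (0 : ℝ)..t,
            groupBracket E N (NormedSpace.exp (s • J) k) (NormedSpace.exp (s • J) x₂) := by
  have hP := hasDerivAt_exp_smul_apply' J hk
  have hR := hasDerivAt_exp_smul_apply' J hl
  have hS := hasDerivAt_exp_smul_apply' J hm
  have hQc := continuous_exp_smul_apply J x₂
  have hPc := continuous_exp_smul_apply J k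
  have hcu : ∀ t : ℝ, HasDerivAt (fun t : ℝ => (1 / 12 * t ^ 3 : ℝ)) (1 / 4 * t ^ 2) t := fun t =>
    ((hasDerivAt_pow 3 t).const_mul (1 / 12 : ℝ)).congr_deriv (by norm_num; ring)
  have hha : ∀ t : ℝ, HasDerivAt (fun t : ℝ => (1 / 2 * t : ℝ)) (1 / 2) t := fun t =>
    ((hasDerivAt_id t).const_mul (1 / 2 : ℝ)).congr_deriv (by simp)
  refine eq_of_hasDerivAt_eq (f' := fun t => -(1 / 2 : ℝ) •
    groupBracket E N (x₁ + NormedSpace.exp (t • J) x₂ + t • y₁)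
      (t • x₁ + (NormedSpace.exp (t • J) k - k) + (1 / 2 * t ^ 2 : ℝ) • y₁))
    (f := fun t => -(1 / 2 : ℝ) • ∫ s in (0 : ℝ)..t,
        groupBracket E N (x₁ + NormedSpace.exp (s • J) x₂ + s • y₁)
          (s • x₁ + (NormedSpace.exp (s • J) k - k) + (1 / 2 * s ^ 2 : ℝ) • y₁))
    (fun t => (hasDerivAt_intervalIntegral
      (((groupBracket E N).continuous.comp (by fun_prop)).clm_apply (by fun_prop)) t).const_smul _)
    (g := fun t => (1 / 2 * t : ℝ) • groupBracket E N (x₁ + (1 / 2 * t : ℝ) • y₁)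
          (NormedSpace.exp (t • J) k + k)
        - t • groupBracket E N y₁ (NormedSpace.exp (t • J) l)
        + (1 / 12 * t ^ 3 : ℝ) • groupBracket E N x₁ y₁
        + (1 / 2 : ℝ) • groupBracket E N (NormedSpace.exp (t • J) k - k) k
        - groupBracket E N x₁ (NormedSpace.exp (t • J) l - l)
        + groupBracket E N y₁ (NormedSpace.exp (t • J) m - m)
        + (1 / 2 : ℝ) • ∫ s in (0 : ℝ)..t,
            groupBracket E N (NormedSpace.exp (s • J) k) (NormedSpace.exp (s • J) x₂))
    (fun t => ?_) ?_ t
  · refine ((((((((hha t).smul ((((hha t).smul_const y₁).const_add x₁).groupBracket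
      ((hP t).add_const k))).sub ((hasDerivAt_id t).smul
        ((hasDerivAt_const t y₁).groupBracket (hR t)))).add ((hcu t).smul_const _)).add
        ((((hP t).sub_const k).groupBracket (hasDerivAt_const t k)).const_smul _)).sub
        ((hasDerivAt_const t x₁).groupBracket ((hR t).sub_const l))).add
        ((hasDerivAt_const t y₁).groupBracket ((hS t).sub_const m))).add
        ((hasDerivAt_intervalIntegral (((groupBracket E N).continuous.comp hPc).clm_apply hQc)
          t).const_smul _)).congr_deriv ?_
    simp only [Function.comp_apply]
    generalize NormedSpace.exp (t • J) k = P
    generalize NormedSpace.exp (t • J) l = R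
    generalize NormedSpace.exp (t • J) x₂ = Q
    have h1 : groupBracket E N Q x₁ = -groupBracket E N x₁ Q := groupBracket_skew _ _
    have h3 : groupBracket E N Q P = -groupBracket E N P Q := groupBracket_skew _ _
    have h4 : groupBracket E N Q y₁ = -groupBracket E N y₁ Q := groupBracket_skew _ _
    have h5 : groupBracket E N y₁ x₁ = -groupBracket E N x₁ y₁ := groupBracket_skew _ _
    simp only [map_add, map_sub, map_smul, map_zero, _root_.add_apply,
      _root_.smul_apply, _root_.zero_apply, groupBracket_self, h1, h3, h4, h5, id]
    module
  · simp

end Explicit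

/-! ### Solutions of `ẍ = J ẋ` and the theorem -/

section Main

variable {E : Type*} [NormedAddCommGroup E] [NormedSpace ℝ E] [FiniteDimensional ℝ E]
  {N : Type*} [TopologicalSpace N] [ChartedSpace E N] [Group N] [LieGroup 𝓘(ℝ, E) ∞ N]
  [T2Space N] {B : BilinForm ℝ (GroupLieAlgebra 𝓘(ℝ, E) N)}

/-- As `J` takes values in `𝔈`, the part of `ẋ` outside `𝔈` is constant, and initially it is that of
`v₀`. -/
theorem sub_mem_E_of_hasDerivAt (D : NullSplitting B) (hB : B.Nondegenerate) {c v₀ e₀ : E}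
    (he : (e₀ : GroupLieAlgebra 𝓘(ℝ, E) N) ∈ D.E) {x' : ℝ → E}
    (hx' : ∀ t, HasDerivAt x' (groupEnd (D.opJ hB c) (x' t)) t) (hx'0 : x' 0 = v₀ + e₀) (t : ℝ) :
    ((x' t - v₀ : E) : GroupLieAlgebra 𝓘(ℝ, E) N) ∈ D.E := by
  let P : E →L[ℝ] E := groupEnd D.projE
  have hP : ∀ X : E, (X : GroupLieAlgebra 𝓘(ℝ, E) N) ∈ D.E → P X = X := fun X hX =>
    (D.proj_of_mem (i := 3) (j := 3) hX).trans (if_pos rfl)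
  have h : ∀ t, HasDerivAt (fun t => x' t - P (x' t)) 0 t := fun t =>
    ((hx' t).sub (P.hasFDerivAt.comp_hasDerivAt t (hx' t))).congr_deriv
      (sub_eq_zero.2 (hP _ (D.opJ_mem hB _ _)).symm)
  have h0 := is_const_of_deriv_eq_zero (fun t => (h t).differentiableAt)
    (fun t => (h t).deriv) t 0
  have h1 : x' t - v₀ = P (x' t) + (e₀ - P (v₀ + e₀)) := by
    simp only [hx'0] at h0
    rw [sub_eq_iff_eq_add]
    exact (sub_eq_iff_eq_add.1 h0).trans (by abel)
  rw [h1, map_add, hP e₀ he]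
  have h2 : P (x' t) + (e₀ - (P v₀ + e₀)) = P (x' t - v₀) := by rw [map_sub]; abel
  rw [h2]
  exact D.projE_mem _

theorem solvesGeodesicEquations_of_opJ (hBs : B.IsSymm)
    (hB : B.Nondegenerate) (h2 : ∀ X Y Z : E, groupBracket E N X (groupBracket E N Y Z) = 0)
    (D : NullSplitting B) {u₀ z₀ v₀ e₀ : E} (hu : (u₀ : GroupLieAlgebra 𝓘(ℝ, E) N) ∈ D.U)
    (hz : (z₀ : GroupLieAlgebra 𝓘(ℝ, E) N) ∈ D.Z) (he : (e₀ : GroupLieAlgebra 𝓘(ℝ, E) N) ∈ D.E)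
    {x x' : ℝ → E} (hx : ∀ t, HasDerivAt x (x' t) t)
    (hx' : ∀ t, HasDerivAt x' (groupEnd (D.opJ hB (z₀ + v₀ : E)) (x' t)) t) (hx0 : x 0 = 0)
    (hx'0 : x' 0 = v₀ + e₀) :
    SolvesGeodesicEquations (leftInvariantMetric B) (u₀ + z₀ + v₀ + e₀ : E)
      (geodesicCoordinates D hB u₀ z₀ v₀ x) :=
  solvesGeodesicEquations_geodesicCoordinates hBs hB h2 D hu hz hx hx' hx0 hx'0
    (sub_mem_E_of_hasDerivAt D hB he hx' hx'0)

/-- The velocity of `t v₀ + ∫ (e^{sJ} e₀ + ∫ e^{σJ} J v₀)` solves `ẍ = J ẋ`. -/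
theorem solvesGeodesicEquations_quadrature (hBs : B.IsSymm)
    (hB : B.Nondegenerate) (h2 : ∀ X Y Z : E, groupBracket E N X (groupBracket E N Y Z) = 0)
    (D : NullSplitting B) {u₀ z₀ v₀ e₀ : E} (hu : (u₀ : GroupLieAlgebra 𝓘(ℝ, E) N) ∈ D.U)
    (hz : (z₀ : GroupLieAlgebra 𝓘(ℝ, E) N) ∈ D.Z) (he : (e₀ : GroupLieAlgebra 𝓘(ℝ, E) N) ∈ D.E)
    {J : E →L[ℝ] E} (hJ : J = groupEnd (D.opJ hB (z₀ + v₀ : E))) :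
    SolvesGeodesicEquations (leftInvariantMetric B) (u₀ + z₀ + v₀ + e₀ : E)
      (geodesicCoordinates D hB u₀ z₀ v₀ fun t : ℝ => (t • v₀ + ∫ s in (0 : ℝ)..t,
        (NormedSpace.exp (s • J) e₀ + ∫ σ in (0 : ℝ)..s, NormedSpace.exp (σ • J) (J v₀)) : E)) := by
  simp only [integral_exp_smul_apply]
  -- With the inner integral evaluated as `e^{sJ}v₀ - v₀`, the velocity collapses to `e^{sJ}(v₀ +
  -- e₀)`.
  have h1 : ∀ s : ℝ, v₀ + (NormedSpace.exp (s • J) e₀ + (NormedSpace.exp (s • J) v₀ - v₀)) =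
      NormedSpace.exp (s • J) (v₀ + e₀) := by
    intro s
    rw [map_add]
    abel
  refine solvesGeodesicEquations_of_opJ hBs hB h2 D hu hz he
    (x' := fun t => NormedSpace.exp (t • J) (v₀ + e₀)) (fun t => ?_) (fun t => ?_) (by simp)
    (by simp)
  · have hc : Continuous fun s : ℝ =>
        NormedSpace.exp (s • J) e₀ + (NormedSpace.exp (s • J) v₀ - v₀) :=
      (continuous_exp_smul_apply J e₀).add
        ((continuous_exp_smul_apply J v₀).sub continuous_const)
    refine (((hasDerivAt_id t).smul_const v₀).add (hasDerivAt_intervalIntegral hc t)).congr_deriv ?_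
    rw [one_smul, h1]
  · rw [← hJ]
    exact hasDerivAt_exp_smul_apply J _ t

/-- The explicit curve solves `ẍ = J ẋ`. -/
theorem solvesGeodesicEquations_explicit (hBs : B.IsSymm)
    (hB : B.Nondegenerate) (h2 : ∀ X Y Z : E, groupBracket E N X (groupBracket E N Y Z) = 0)
    (D : NullSplitting B) {u₀ z₀ v₀ e₀ : E} (hu : (u₀ : GroupLieAlgebra 𝓘(ℝ, E) N) ∈ D.U)
    (hz : (z₀ : GroupLieAlgebra 𝓘(ℝ, E) N) ∈ D.Z) (he : (e₀ : GroupLieAlgebra 𝓘(ℝ, E) N) ∈ D.E)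
    {J : E →L[ℝ] E} (hJ : J = groupEnd (D.opJ hB (z₀ + v₀ : E))) {x₁ x₂ y₁ k : E}
    (hk : J k = x₂) (hx₁ : J x₁ = y₁) (hy₁ : J y₁ = 0) (h12 : x₁ + x₂ = v₀ + e₀) :
    SolvesGeodesicEquations (leftInvariantMetric B) (u₀ + z₀ + v₀ + e₀ : E)
      (geodesicCoordinates D hB u₀ z₀ v₀ fun t : ℝ =>
        (t • x₁ + (NormedSpace.exp (t • J) k - k) + (1 / 2 * t ^ 2 : ℝ) • y₁ : E)) ∧
    ∀ t, HasDerivAt (fun t : ℝ =>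
      t • x₁ + (NormedSpace.exp (t • J) k - k) + (1 / 2 * t ^ 2 : ℝ) • y₁)
      (x₁ + NormedSpace.exp (t • J) x₂ + t • y₁) t := by
  have hx : ∀ t, HasDerivAt (fun t : ℝ =>
      t • x₁ + (NormedSpace.exp (t • J) k - k) + (1 / 2 * t ^ 2 : ℝ) • y₁)
      (x₁ + NormedSpace.exp (t • J) x₂ + t • y₁) t := fun t =>
    ((((hasDerivAt_id t).smul_const x₁).add ((hasDerivAt_exp_smul_apply' J hk t).sub_const k)).add
      (((hasDerivAt_pow 2 t).const_mul (1 / 2 : ℝ)).smul_const y₁)).congr_deriv (by simp)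
  refine ⟨solvesGeodesicEquations_of_opJ hBs hB h2 D hu hz he hx (fun t => ?_) (by simp)
    (by simpa using h12), hx⟩
  rw [← hJ]
  refine (((hasDerivAt_exp_smul_apply J x₂ t).const_add x₁).add
    ((hasDerivAt_id t).smul_const y₁)).congr_deriv ?_
  simp only [map_add, map_smul, hx₁, hy₁, smul_zero, one_smul]
  abel

end Main

theorem mainTheorem7
    {E : Type*} [NormedAddCommGroup E] [NormedSpace ℝ E] [FiniteDimensional ℝ E]
    {N : Type*} [TopologicalSpace N] [ChartedSpace E N] [Group N] [LieGroup 𝓘(ℝ, E) ∞ N]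
    [T2Space N] [ConnectedSpace N]
    (h_two_step : ∀ x y : GroupLieAlgebra 𝓘(ℝ, E) N,
      ⁅x, y⁆ ∈ LieAlgebra.center ℝ (GroupLieAlgebra 𝓘(ℝ, E) N))
    (B : BilinForm ℝ (GroupLieAlgebra 𝓘(ℝ, E) N)) (hB_symm : B.IsSymm) (hB : B.Nondegenerate) :
    (∀ (D : NullSplitting B), ∀ u₀ ∈ D.U, ∀ z₀ ∈ D.Z, ∀ v₀ ∈ D.V, ∀ e₀ ∈ D.E,
      -- `J` and `e^{tJ}` on `𝔈`, and `J⁻¹` on `𝔈₂`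
      let J := D.opJ hB (z₀ + v₀)
      let eJ : ℝ → GroupLieAlgebra 𝓘(ℝ, E) N → GroupLieAlgebra 𝓘(ℝ, E) N := fun t => opExp (t • J)
      let E₁ := D.E₁ hB (z₀ + v₀)
      let E₂ := D.E₂ hB (z₀ + v₀)
      let K := D.invJ hB (z₀ + v₀)
      -- for arbitrary initial data, the geodesic equations are integrated by quadratures
      SolvesGeodesicEquations (leftInvariantMetric B) (u₀ + z₀ + v₀ + e₀)
        (geodesicCoordinates D hB u₀ z₀ v₀ fun t =>
          t • v₀ + lieIntegral (fun s => eJ s e₀ + lieIntegral (fun σ => eJ σ (J v₀)) s) t) ∧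
      -- when `𝔈 = 𝔈₁ ⊕ 𝔈₂`, they are integrated in terms of `J⁻¹`
      (E₁ ⊔ E₂ = D.E →
        Set.BijOn J E₂ E₂ ∧
        ∀ e₁ ∈ E₁, ∀ e₂ ∈ E₂, ∀ y₁ ∈ E₁, ∀ y₂ ∈ E₂, e₀ = e₁ + e₂ → J v₀ = y₁ + y₂ →
          let x₁ := e₁ + v₀ - K y₂
          let x₂ := e₂ + K y₂
          let x : ℝ → GroupLieAlgebra 𝓘(ℝ, E) N := fun t =>
            t • x₁ + (eJ t (K x₂) - K x₂) + (1 / 2 * t ^ 2 : ℝ) • y₁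
          SolvesGeodesicEquations (leftInvariantMetric B) (u₀ + z₀ + v₀ + e₀)
            (geodesicCoordinates D hB u₀ z₀ v₀ x) ∧
          ∀ t : ℝ, bracketIntegral x t =
            (1 / 2 * t : ℝ) • ⁅x₁ + (1 / 2 * t : ℝ) • y₁, eJ t (K x₂) + K x₂⁆
            - t • ⁅y₁, eJ t (K (K x₂))⁆
            + (1 / 12 * t ^ 3 : ℝ) • ⁅x₁, y₁⁆
            + (1 / 2 : ℝ) • ⁅eJ t (K x₂) - K x₂, K x₂⁆
            - ⁅x₁, eJ t (K (K x₂)) - K (K x₂)⁆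
            + ⁅y₁, eJ t (K (K (K x₂))) - K (K (K x₂))⁆
            + (1 / 2 : ℝ) • lieIntegral (fun s => ⁅eJ s (K x₂), eJ s x₂⁆) t)) ∧
    IsGeodesicallyComplete (leftInvariantMetric B) := by
  have h2 : ∀ X Y Z : E, groupBracket E N X (groupBracket E N Y Z) = 0 := fun X Y Z =>
    mem_center_iff_groupBracket.1 (h_two_step Y Z) X
  refine ⟨fun D u₀ hu z₀ hz v₀ hv e₀ he => ?_,
    isGeodesicallyComplete_leftInvariantMetric hB_symm hB h2⟩
  intro J eJ E₁ E₂ K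
  have hq := solvesGeodesicEquations_quadrature hB_symm hB h2 D hu hz he (J := groupEnd J) rfl
  refine ⟨hq, fun hE => ?_⟩
  have hbij : Set.BijOn J E₂ E₂ := D.bijOn_opJ hB_symm hB (z₀ + v₀) hE
  refine ⟨hbij, fun e₁ he₁ e₂ he₂ y₁ hy₁ y₂ hy₂ h_e h_y => ?_⟩
  have hKmem : ∀ y ∈ E₂, K y ∈ E₂ := fun y hy => Function.invFunOn_mem (hbij.surjOn hy)
  have hJK : ∀ y ∈ E₂, J (K y) = y := fun y hy => Function.invFunOn_eq (hbij.surjOn hy)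
  intro x₁ x₂ x
  have hx₂ : x₂ ∈ E₂ := E₂.add_mem he₂ (hKmem _ hy₂)
  -- Subtracting `J⁻¹y₂` from `v₀` leaves only the kernel part of `J v₀`. Hence `J² x₁ = 0`, and
  -- `x₁` contributes only a quadratic polynomial in `t`.
  have hJx₁ : J x₁ = y₁ := by
    have h1 : J e₁ = 0 := he₁.2
    change J (e₁ + v₀ - K y₂) = y₁
    rw [map_sub, map_add, h1, h_y, hJK _ hy₂, zero_add, add_sub_cancel_right]
  have h12 : x₁ + x₂ = v₀ + e₀ := by
    change e₁ + v₀ - K y₂ + (e₂ + K y₂) = v₀ + e₀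
    rw [h_e]
    abel
  obtain ⟨h3, h4⟩ := solvesGeodesicEquations_explicit hB_symm hB h2 D hu hz he
    (J := groupEnd J) rfl (hJK _ hx₂) hJx₁ hy₁.2 h12
  have h5 := integral_groupBracket_explicit (E := E) (N := N) (groupEnd J) (x₁ := x₁) (y₁ := y₁)
    (hJK _ hx₂) (hJK _ (hKmem _ hx₂)) (hJK _ (hKmem _ (hKmem _ hx₂)))
  exact ⟨h3, fun t => (bracketIntegral_eq h4 t).trans (h5 t)⟩
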